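/- **Setting.** Let $d,n,b\ge 1$, $1\le \ell\le d$, $m>1$ and $T\ge 0$ be integers and $L>0$. Let $f_1,\dots,f_n:\mathbb R^d\to\mathbb R$ be differentiable with $\|\nabla f_i(x)-\nabla f_i(y)\|\le L\|x-y\|$ for all $x,y\in\mathbb R^d$ and all $i$, and put $f=\frac1n\sum_{i=1}^n f_i$. Let $h:\mathbb R^d\to(-\infty,+\infty]$ be proper, convex and proximable, i.e. $\operatorname{prox}_{\gamma h}(x)=\operatorname{argmin}_y\{h(y)+\frac1{2\gamma}\|y-x\|^2\}$ exists for all $x\in\mathbb R^d$, $\gamma>0$. Put $F=f+h$ and assume that $F$ attains its minimum on $\mathbb R^d$. For $\gamma>0$ let $\mathcal G_\gamma(x)=\frac1\gamma\bigl(x-\operatorname{prox}_{\gamma h}(x-\gamma\nabla f(x))\bigr)$. For $\beta>0$ and an orthogonal matrix $G\in O(d)$, with $(e_j)$ the canonical basis, let $$g(x,\beta)=\sum_{j=1}^d\frac{f(x+\beta e_j)-f(x)}{\beta}e_j,\qquad \hat g_i(x,G,\beta)=\frac d\ell\sum_{j=1}^{\ell}\frac{f_i(x+\beta Ge_j)-f_i(x)}{\beta}Ge_j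 .$$ **Algorithm (VR-SZD).** Given $x_0^0\in\mathbb R^d$, $\gamma>0$ and $(\beta_\tau)_{\tau\in\mathbb N}$ with $\beta_\tau>0$: for $\tau=0,\dots,T$ and $k=0,\dots,m-1$, sample $i_{1,k}^\tau,\dots,i_{b,k}^\tau$ uniformly from $\{1,\dots,n\}$ and $G_{1,k}^\tau,\dots,G_{b,k}^\tau$ from the normalized Haar measure of $O(d)$, all samples (over all $\tau,k,j$) being independent, and set $$v_k^\tau=\frac1b\sum_{j=1}^b\Bigl(\hat g_{i_{j,k}^\tau}(x_k^\tau,G_{j,k}^\tau,\beta_\tau)-\hat g_{i_{j,k}^\tau}(x_0^\tau,G_{j,k}^\tau,\beta_\tau)\Bigr)+g(x_0^\tau,\beta_\tau),\qquad x_{k+1}^\tau=\operatorname{prox}_{\gamma h}(x_k^\tau-\gamma v_k^\tau),$$ and $x_0^{\tau+1}=x_m^\tau$. **Theorem.** Suppose $$0<\gamma<\min\left(\frac1{4L},\ \frac{\sqrt{\ell b}}{\sqrt{32(e-1)d}\,L\,m}\right),\qquad \Delta=\frac12-L\gamma ,$$ where $e$ is Euler's number. Then $\|\mathcal G_\gamma(x_k^\tau)\|^2$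 is integrable for all $0\le\tau\le T$, $0\le k\le m-1$, and $$\eta_m^T:=\frac1{(T+1)m}\sum_{\tau=0}^T\sum_{k=0}^{m-1}\mathbb E\bigl[\|\mathcal G_\gamma(x_k^\tau)\|^2\bigr]\ \le\ \frac{F(x_0^0)-\min F}{\Delta\gamma m(T+1)}+\left(\frac{3d}{\ell b}+2+3d\right)\frac{L^2d}{\Delta(T+1)}\sum_{\tau=0}^T\beta_\tau^2 ,$$ where the right-hand side is $+\infty$ if $F(x_0^0)=+\infty$. -/

import Mathlib

open MeasureTheory ProbabilityTheory

noncomputable section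

namespace VRSZD

/-- Euclidean space `ℝ^d`. -/
abbrev E (d : ℕ) : Type := EuclideanSpace ℝ (Fin d)

/-- The orthogonal group `O(d)`. -/
abbrev O (d : ℕ) : Type := Matrix.orthogonalGroup (Fin d) ℝ

/-- `O(d)` carries its Borel `σ`-algebra. -/
instance instMeasurableSpaceO (d : ℕ) : MeasurableSpace (O d) := borel (O d)

instance instBorelSpaceO (d : ℕ) : BorelSpace (O d) := ⟨rfl⟩

/-- `φ` is `L`-smooth: differentiable with `L`-Lipschitz gradient. -/
def IsSmoothWith {d : ℕ} (L : ℝ) (φ : E d → ℝ) : Prop :=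
  Differentiable ℝ φ ∧ ∀ x y : E d, ‖gradient φ x - gradient φ y‖ ≤ L * ‖x - y‖

/-- `y` belongs to `argmin_z { h z + ‖z - x‖² / (2γ) }`. -/
def IsProxPoint {d : ℕ} (h : E d → EReal) (γ : ℝ) (x y : E d) : Prop :=
  ∀ z : E d, h y + ((1 / (2 * γ) * ‖y - x‖ ^ 2 : ℝ) : EReal)
    ≤ h z + ((1 / (2 * γ) * ‖z - x‖ ^ 2 : ℝ) : EReal)

/-- `h : ℝ^d → (-∞, +∞]` is proper, convex (its epigraph is convex) and proximable (the proximal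
problem has a solution for every centre and every parameter; by strict convexity the solution is
then unique). -/
structure IsConvexProximable {d : ℕ} (h : E d → EReal) : Prop where
  ne_bot : ∀ x, h x ≠ ⊥
  proper : ∃ x, h x ≠ ⊤
  convex : Convex ℝ {p : E d × ℝ | h p.1 ≤ (p.2 : EReal)}
  proximable : ∀ γ : ℝ, 0 < γ → ∀ x : E d, ∃ y : E d, IsProxPoint h γ x y

open Classical in
/-- The proximal operator `prox_{γ h}`; the default value is irrelevant for proximable `h`. -/
def prox {d : ℕ} (h : E d → EReal) (γ : ℝ) (x : E d) : E d :=
  if hx : ∃ y : E d, IsProxPoint h γ x y then hx.choose else x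

/-- The finite average `f = (1/n) ∑ i, f_i`. -/
def avg {d n : ℕ} (f : Fin n → E d → ℝ) (x : E d) : ℝ :=
  (1 / (n : ℝ)) * ∑ i, f i x

/-- The objective `F = f + h`, with values in `(-∞, +∞]`. -/
def objective {d n : ℕ} (f : Fin n → E d → ℝ) (h : E d → EReal) (x : E d) : EReal :=
  ((avg f x : ℝ) : EReal) + h x

/-- The canonical basis vector `e_j`. -/
def e {d : ℕ} (j : Fin d) : E d := EuclideanSpace.single j 1

/-- The rotated canonical vector `G e_j`. -/
def dir {d : ℕ} (G : O d) (j : Fin d) : E d :=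
  Matrix.toEuclideanLin (G : Matrix (Fin d) (Fin d) ℝ) (e j)

/-- Forward finite differences of `φ` along the canonical basis:
`∑_{j=1}^d (φ(x + β e_j) - φ(x)) / β • e_j`. -/
def fullApprox {d : ℕ} (φ : E d → ℝ) (x : E d) (β : ℝ) : E d :=
  ∑ j : Fin d, ((φ (x + β • e j) - φ x) / β) • e j

/-- Structured forward finite differences of `φ`, along the first `ℓ` columns of `G`:
`(d/ℓ) ∑_{j=1}^ℓ (φ(x + β G e_j) - φ(x)) / β • G e_j`. -/
def structApprox {d : ℕ} (ℓ : ℕ) (φ : E d → ℝ) (x : E d) (G : O d) (β : ℝ) : E d :=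
  ((d : ℝ) / (ℓ : ℝ)) • ∑ j ∈ Finset.univ.filter (fun j : Fin d => (j : ℕ) < ℓ),
    ((φ (x + β • dir G j) - φ x) / β) • dir G j

/-- The search direction: from the snapshot `x₀`, the current inner iterate `x`, the sampled
indices `i` and the sampled orthogonal matrices `G`,
`(1/b) ∑_{j=1}^b (ĝ_{i_j}(x, G_j, β) - ĝ_{i_j}(x₀, G_j, β)) + g(x₀, β)`. -/
def direction {d n b : ℕ} (ℓ : ℕ) (f : Fin n → E d → ℝ) (β : ℝ) (x₀ x : E d)
    (i : Fin b → Fin n) (G : Fin b → O d) : E d :=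
  (1 / (b : ℝ)) • ∑ j : Fin b,
      (structApprox ℓ (f (i j)) x (G j) β - structApprox ℓ (f (i j)) x₀ (G j) β)
    + fullApprox (avg f) x₀ β

/-- The gradient mapping `𝒢_γ(x) = (x - prox_{γ h}(x - γ ∇f(x))) / γ`. -/
def gradMap {d n : ℕ} (f : Fin n → E d → ℝ) (h : E d → EReal) (γ : ℝ) (x : E d) : E d :=
  (1 / γ) • (x - prox h γ (x - γ • gradient (avg f) x))

/-- `x τ k` (`0 ≤ τ ≤ T`, `0 ≤ k ≤ m`) are the iterates of VR-SZD with input `x₀`, driven by the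
samples `i τ k j` (uniform on `[n]`) and `G τ k j` (distributed according to the normalized Haar
measure of `O(d)`), all of them independent. -/
structure IsRun {Ω : Type*} [MeasurableSpace Ω] (P : Measure Ω) {d n b : ℕ} (ℓ m T : ℕ)
    (f : Fin n → E d → ℝ) (h : E d → EReal) (γ : ℝ) (β : ℕ → ℝ) (x₀ : E d)
    (i : ℕ → ℕ → Fin b → Ω → Fin n) (G : ℕ → ℕ → Fin b → Ω → O d)
    (x : ℕ → ℕ → Ω → E d) : Prop where
  measurable_i : ∀ τ ≤ T, ∀ k < m, ∀ j, Measurable (i τ k j)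
  measurable_G : ∀ τ ≤ T, ∀ k < m, ∀ j, Measurable (G τ k j)
  /-- each index is uniform on `[n]` -/
  law_i : ∀ τ ≤ T, ∀ k < m, ∀ j, P.map (i τ k j) = uniformOn (Set.univ : Set (Fin n))
  /-- each matrix is uniform on `O(d)`: its law, a probability measure, is a Haar measure -/
  law_G : ∀ τ ≤ T, ∀ k < m, ∀ j, (P.map (G τ k j)).IsHaarMeasure
  /-- the pairs `(i τ k j, G τ k j)` are mutually independent ... -/
  indep : iIndepFun (fun (p : Fin (T + 1) × Fin m × Fin b) (ω : Ω) =>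
    (i p.1 p.2.1 p.2.2 ω, G p.1 p.2.1 p.2.2 ω)) P
  /-- ... and so are the two members of each pair -/
  indep_pair : ∀ τ ≤ T, ∀ k < m, ∀ j, IndepFun (i τ k j) (G τ k j) P
  init : ∀ ω, x 0 0 ω = x₀
  inner : ∀ τ ≤ T, ∀ k < m, ∀ ω, x τ (k + 1) ω =
    prox h γ (x τ k ω - γ • direction ℓ f (β τ) (x τ 0 ω) (x τ k ω)
      (fun j => i τ k j ω) (fun j => G τ k j ω))
  outer : ∀ τ ≤ T, ∀ ω, x (τ + 1) 0 ω = x τ m ω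

/-- `η_m^T = (1 / ((T+1) m)) ∑_{τ=0}^T ∑_{k=0}^{m-1} 𝔼 ‖𝒢_γ(x_k^τ)‖²`. -/
def eta {Ω : Type*} [MeasurableSpace Ω] (P : Measure Ω) {d n : ℕ} (m T : ℕ)
    (f : Fin n → E d → ℝ) (h : E d → EReal) (γ : ℝ) (x : ℕ → ℕ → Ω → E d) : ℝ :=
  1 / (((T : ℝ) + 1) * (m : ℝ)) * ∑ τ ∈ Finset.range (T + 1), ∑ k ∈ Finset.range m,
    ∫ ω, ‖gradMap f h γ (x τ k ω)‖ ^ 2 ∂P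

end VRSZD

end

noncomputable section

namespace VRSZD

open scoped RealInnerProductSpace

/-! Let `v` be the search direction at a point `x` of the domain of `h`, and `y` the next iterate.
Convexity of `h` and smoothness of `f` give, for an arbitrary `v`, an inexact descent inequality
(`prox_step_le`): `F` decreases by at least `Δ γ ‖𝒢_γ(x)‖² + (1/(2γ) - L/2) ‖y - x‖²`, up to the
error `γ/2 ‖v - ∇f(x)‖²`. Telescoping over both loops bounds the sum of `‖𝒢_γ‖²`, provided the
displacement terms can pay for the errors.

The columns of a Haar matrix are orthonormal and isotropic. Hence, up to a bias of order `β`, the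
structured difference at `x` minus the one at the snapshot `x₀` is an unbiased estimator of `∇f(x) -
∇f(x₀)`, with second moment of order `(d/ℓ) L² ‖x - x₀‖²`. Averaging `b` independent copies divides
the variance by `b`, and the full finite difference supplies `∇f(x₀)` up to a deterministic bias.
The mean squared error is thus at most `2d/(ℓb) L² ‖x - x₀‖² + O(β²)`
(`integral_norm_direction_sub_gradient_sq_le`). Iterates depend only on past samples, so this
estimate for fixed points may be integrated along the run
(`IsRun.integral_norm_directionError_sq_le`).

Inside an inner loop, Cauchy–Schwarz bounds the distances to the snapshot by the displacements at
the price of `m²/2` (`sum_norm_sub_sq_le`). The step size makes the negative displacement terms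
dominate (`step_size_le`), so only the initial gap and the `β²` terms survive. -/

/-! ### Smoothness of the components and of their average -/

/-- Along `t ↦ x + t v` the derivative of the remainder is at most `L ‖v‖² t`, the derivative of
`L/2 ‖v‖² t²`. The mean value inequality on `[0, 1]` then avoids integrating the gradient. -/
theorem IsSmoothWith.abs_sub_sub_inner_le {d : ℕ} {L : ℝ} {φ : E d → ℝ}
    (hφ : IsSmoothWith L φ) (x v : E d) :
    |φ (x + v) - φ x - ⟪gradient φ x, v⟫| ≤ L / 2 * ‖v‖ ^ 2 := by
  have key := image_norm_le_of_norm_deriv_right_le_deriv_boundary (a := 0) (b := 1)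
    (f := fun t : ℝ => φ (x + t • v) - φ x - t * ⟪gradient φ x, v⟫)
    (f' := fun t : ℝ => ⟪gradient φ (x + t • v), v⟫ - ⟪gradient φ x, v⟫)
    (B := fun t : ℝ => L / 2 * ‖v‖ ^ 2 * t ^ 2) (B' := fun t : ℝ => L * ‖v‖ ^ 2 * t)
  have hd : ∀ t : ℝ, HasDerivAt (fun t : ℝ => φ (x + t • v) - φ x - t * ⟪gradient φ x, v⟫)
      (⟪gradient φ (x + t • v), v⟫ - ⟪gradient φ x, v⟫) t := by
    intro t
    have h1 : HasDerivAt (fun t : ℝ => x + t • v) v t := by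
      simpa using ((hasDerivAt_id t).smul_const v).const_add x
    have h2 := (hφ.1 (x + t • v)).hasGradientAt.hasFDerivAt.comp_hasDerivAt t h1
    have h3 := (h2.sub_const (φ x)).sub ((hasDerivAt_id t).mul_const ⟪gradient φ x, v⟫)
    simp only [id, one_mul, InnerProductSpace.toDual_apply_apply] at h3
    exact h3
  have := key (fun t _ => (hd t).continuousAt.continuousWithinAt)
    (fun t _ => (hd t).hasDerivWithinAt) (by simp) (fun t => by
      have := ((hasDerivAt_id t).pow 2).const_mul (L / 2 * ‖v‖ ^ 2)
      have h2 : L / 2 * ‖v‖ ^ 2 * (((2 : ℕ) : ℝ) * id t ^ (2 - 1) * 1) = L * ‖v‖ ^ 2 * t := by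
        simp only [id]; norm_num; ring
      rw [h2] at this
      exact this) (fun t ht => by
      rw [← inner_sub_left]
      refine (norm_inner_le_norm _ _).trans ?_
      have h4 := hφ.2 (x + t • v) x
      rw [add_sub_cancel_left, norm_smul, Real.norm_of_nonneg ht.1] at h4
      nlinarith [mul_le_mul_of_nonneg_right h4 (norm_nonneg v)])
    (Set.right_mem_Icc.2 zero_le_one)
  simpa using this

theorem gradient_avg {d n : ℕ} {L : ℝ} {f : Fin n → E d → ℝ} (hf : ∀ i, IsSmoothWith L (f i))
    (x : E d) : gradient (avg f) x = (1 / (n : ℝ)) • ∑ i, gradient (f i) x := by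
  apply HasGradientAt.gradient
  rw [hasGradientAt_iff_hasFDerivAt]
  have h1 : HasFDerivAt (fun x => ∑ i, f i x)
      (∑ i, (InnerProductSpace.toDual ℝ (E d)) (gradient (f i) x)) x :=
    HasFDerivAt.fun_sum fun i _ => ((hf i).1 x).hasGradientAt.hasFDerivAt
  have := h1.const_mul (1 / (n : ℝ))
  rw [map_smul, map_sum]
  exact this

theorem differentiable_avg {d n : ℕ} {L : ℝ} {f : Fin n → E d → ℝ}
    (hf : ∀ i, IsSmoothWith L (f i)) : Differentiable ℝ (avg f) := by
  unfold avg
  exact (Differentiable.fun_sum fun i _ => (hf i).1).const_mul _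

theorem isSmoothWith_avg {d n : ℕ} {L : ℝ} (hn : 0 < n) {f : Fin n → E d → ℝ}
    (hf : ∀ i, IsSmoothWith L (f i)) : IsSmoothWith L (avg f) := by
  refine ⟨differentiable_avg hf, fun x y => ?_⟩
  have hn' : (0 : ℝ) < n := by exact_mod_cast hn
  rw [gradient_avg hf, gradient_avg hf, ← smul_sub, ← Finset.sum_sub_distrib, norm_smul,
    Real.norm_of_nonneg (by positivity)]
  have h1 : ‖∑ i, (gradient (f i) x - gradient (f i) y)‖ ≤ n * (L * ‖x - y‖) := by
    refine (norm_sum_le _ _).trans ?_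
    refine (Finset.sum_le_sum fun i _ => (hf i).2 x y).trans ?_
    simp
  calc 1 / (n : ℝ) * _ ≤ 1 / (n : ℝ) * (n * (L * ‖x - y‖)) := by gcongr
    _ = L * ‖x - y‖ := by field_simp

theorem IsSmoothWith.continuous_gradient {d : ℕ} {L : ℝ} {φ : E d → ℝ}
    (hφ : IsSmoothWith L φ) : Continuous (gradient φ) := by
  have : LipschitzWith L.toNNReal (gradient φ) := by
    refine LipschitzWith.of_dist_le_mul fun x y => ?_
    rw [dist_eq_norm, dist_eq_norm]
    refine (hφ.2 x y).trans ?_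
    gcongr
    exact Real.le_coe_toNNReal L
  exact this.continuous

/-! ### The proximal operator and inexact descent -/

theorem isProxPoint_prox {d : ℕ} {h : E d → EReal} (hh : IsConvexProximable h) {γ : ℝ}
    (hγ : 0 < γ) (x : E d) : IsProxPoint h γ x (prox h γ x) := by
  have hx := hh.proximable γ hγ x
  unfold prox
  rw [dif_pos hx]
  exact hx.choose_spec

theorem prox_ne_top {d : ℕ} {h : E d → EReal} (hh : IsConvexProximable h) {γ : ℝ}
    (hγ : 0 < γ) (x : E d) : h (prox h γ x) ≠ ⊤ := by
  obtain ⟨z, hz⟩ := hh.proper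
  have h1 := isProxPoint_prox hh hγ x z
  intro htop
  rw [htop, EReal.top_add_coe, top_le_iff] at h1
  exact (EReal.add_ne_top hz (EReal.coe_ne_top _)) h1

/-- The variational inequality that characterizes the proximal point. -/
theorem prox_variational {d : ℕ} {h : E d → EReal} (hh : IsConvexProximable h) {γ : ℝ}
    (hγ : 0 < γ) (x z : E d) (hz : h z ≠ ⊤) :
    (h (prox h γ x)).toReal + 1 / γ * ⟪x - prox h γ x, z - prox h γ x⟫ ≤ (h z).toReal := by
  set y := prox h γ x with hy
  have hyt : h y ≠ ⊤ := prox_ne_top hh hγ x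
  have hp : IsProxPoint h γ x y := isProxPoint_prox hh hγ x
  set a := (h y).toReal
  set c := (h z).toReal
  have ha : h y = (a : EReal) := (EReal.coe_toReal hyt (hh.ne_bot y)).symm
  have hc : h z = (c : EReal) := (EReal.coe_toReal hz (hh.ne_bot z)).symm
  -- Minimality of `y` is tested at `(1 - t) y + t z`, where convexity of the epigraph bounds `h`.
  -- Dividing by `t` leaves an error linear in `t`, which vanishes as `t → 0⁺`.
  have hseg : ∀ t : ℝ, 0 < t → t ≤ 1 →
      1 / γ * ⟪x - y, z - y⟫ - t * (1 / (2 * γ) * ‖z - y‖ ^ 2) ≤ c - a := by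
    intro t ht ht1
    have hconv := hh.convex (x := (y, a)) (by simp [ha]) (y := (z, c)) (by simp [hc])
      (a := 1 - t) (b := t) (by linarith) ht.le (by ring)
    have hw : h ((1 - t) • y + t • z) ≤ (((1 - t) * a + t * c : ℝ) : EReal) := by
      simpa using hconv
    have h2 := (hp ((1 - t) • y + t • z)).trans (add_le_add_left hw _)
    rw [ha] at h2
    norm_cast at h2
    have e1 : (1 - t) • y + t • z - x = (y - x) + t • (z - y) := by module
    have e2 : ‖(1 - t) • y + t • z - x‖ ^ 2
        = ‖y - x‖ ^ 2 - 2 * t * ⟪x - y, z - y⟫ + t ^ 2 * ‖z - y‖ ^ 2 := by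
      rw [e1, norm_add_sq_real, inner_smul_right, norm_smul, mul_pow, ← neg_sub x y, inner_neg_left,
        norm_neg, Real.norm_eq_abs, sq_abs]
      ring
    rw [e2] at h2
    have h3 : t * (1 / γ * ⟪x - y, z - y⟫ - t * (1 / (2 * γ) * ‖z - y‖ ^ 2)) ≤ t * (c - a) := by
      have : 1 / γ = 2 * (1 / (2 * γ)) := by field_simp
      rw [this]
      nlinarith
    exact le_of_mul_le_mul_left h3 ht
  have hlim : Filter.Tendsto (fun t : ℝ => 1 / γ * ⟪x - y, z - y⟫ - t * (1 / (2 * γ) * ‖z - y‖ ^ 2))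
      (nhdsWithin 0 (Set.Ioi 0)) (nhds (1 / γ * ⟪x - y, z - y⟫)) := by
    have : Continuous fun t : ℝ =>
      1 / γ * ⟪x - y, z - y⟫ - t * (1 / (2 * γ) * ‖z - y‖ ^ 2) := by fun_prop
    have h0 := this.tendsto 0
    simp only [zero_mul, sub_zero] at h0
    exact h0.mono_left nhdsWithin_le_nhds
  have := le_of_tendsto hlim (by
    filter_upwards [Ioc_mem_nhdsGT (zero_lt_one' ℝ)] with t ht using hseg t ht.1 ht.2)
  linarith

/-- Each variational inequality is tested at the other proximal point; their sum is `‖y - y'‖² ≤ ⟪x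
- x', y - y'⟫`, and Cauchy–Schwarz concludes. The resulting continuity makes the iterates measurable
and bounded. -/
theorem norm_prox_sub_prox_le {d : ℕ} {h : E d → EReal} (hh : IsConvexProximable h) {γ : ℝ}
    (hγ : 0 < γ) (x x' : E d) : ‖prox h γ x - prox h γ x'‖ ≤ ‖x - x'‖ := by
  have h1 := prox_variational hh hγ x _ (prox_ne_top hh hγ x')
  have h2 := prox_variational hh hγ x' _ (prox_ne_top hh hγ x)
  set y := prox h γ x
  set y' := prox h γ x'
  have h3 : 1 / γ * (⟪x - y, y' - y⟫ + ⟪x' - y', y - y'⟫) ≤ 0 := by linarith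
  have h4 : ⟪x - y, y' - y⟫ + ⟪x' - y', y - y'⟫ ≤ 0 := by
    by_contra hcon
    push Not at hcon
    have : 0 < 1 / γ * (⟪x - y, y' - y⟫ + ⟪x' - y', y - y'⟫) := by positivity
    linarith
  have h5 : ⟪x - y, y' - y⟫ + ⟪x' - y', y - y'⟫ = ‖y - y'‖ ^ 2 - ⟪x - x', y - y'⟫ := by
    rw [← real_inner_self_eq_norm_sq]
    simp only [inner_sub_left, inner_sub_right]
    ring
  have h6 := real_inner_le_norm (x - x') (y - y')
  by_contra hcon
  push Not at hcon
  have : 0 < ‖y - y'‖ := (norm_nonneg _).trans_lt hcon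
  nlinarith

theorem continuous_prox {d : ℕ} {h : E d → EReal} (hh : IsConvexProximable h) {γ : ℝ}
    (hγ : 0 < γ) : Continuous (prox h γ) := by
  have : LipschitzWith 1 (prox h γ) := by
    refine LipschitzWith.of_dist_le_mul fun x y => ?_
    simpa [dist_eq_norm] using norm_prox_sub_prox_le hh hγ x y
  exact this.continuous

/-- Inexact proximal gradient step. -/
theorem prox_step_le {d n : ℕ} {L : ℝ} (hL : 0 ≤ L) (hn : 0 < n) {f : Fin n → E d → ℝ}
    (hf : ∀ i, IsSmoothWith L (f i)) {h : E d → EReal} (hh : IsConvexProximable h) {γ : ℝ}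
    (hγ : 0 < γ) (x v : E d) (hx : h x ≠ ⊤) :
    avg f (prox h γ (x - γ • v)) + (h (prox h γ (x - γ • v))).toReal
        + (1 / 2 - L * γ) * γ * ‖gradMap f h γ x‖ ^ 2
      ≤ avg f x + (h x).toReal
        - (1 / (2 * γ) - L / 2) * ‖prox h γ (x - γ • v) - x‖ ^ 2
        + γ / 2 * ‖v - gradient (avg f) x‖ ^ 2 := by
  set g := gradient (avg f) x with hg
  set y := prox h γ (x - γ • v) with hy
  set p := prox h γ (x - γ • g) with hp
  have hpt : h p ≠ ⊤ := prox_ne_top hh hγ _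
  have hsm := isSmoothWith_avg hn hf
  -- The exact proximal gradient point `p` is the intermediary: `v1` compares `y` with `p`, and `v2`
  -- compares `p` with `x`.
  have v1 := prox_variational hh hγ (x - γ • v) p hpt
  have v2 := prox_variational hh hγ (x - γ • g) x hx
  rw [← hy] at v1
  rw [← hp] at v2
  have d1 := (abs_le.1 (hsm.abs_sub_sub_inner_le x (y - x))).2
  rw [add_sub_cancel, ← hg] at d1
  have hG : gradMap f h γ x = (1 / γ) • (x - p) := rfl
  rw [hG, norm_smul, mul_pow, Real.norm_of_nonneg (by positivity)]
  obtain ⟨u, hu⟩ : ∃ u, u = y - x := ⟨_, rfl⟩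
  obtain ⟨w, hw⟩ : ∃ w, w = p - x := ⟨_, rfl⟩
  obtain ⟨q, hq⟩ : ∃ q, q = v - g := ⟨_, rfl⟩
  have e1 : x - γ • v - y = -(u + γ • (q + g)) := by rw [hu, hq]; module
  have e2 : p - y = w - u := by rw [hu, hw]; module
  have e3 : x - γ • g - p = -(w + γ • g) := by rw [hw]; module
  have e4 : x - p = -w := by rw [hw]; module
  rw [e1, e2] at v1
  rw [e3, e4] at v2
  rw [← hu] at d1
  rw [e4, ← hu, ← hq, norm_neg]
  -- Young's inequality for `⟪q, w - u⟫`, written as a square; its `⟪w, u⟫` term cancels the one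
  -- produced by `v1`.
  have hS : 0 ≤ 1 / γ / 2 * ‖(w - u) - γ • q‖ ^ 2 := by positivity
  -- The argument yields the coefficient `γ/2` for `‖𝒢_γ(x)‖²`; this nonnegative term is given away
  -- to reach the weaker `(1/2 - Lγ) γ`.
  have hww : 0 ≤ L * ‖w‖ ^ 2 := by positivity
  rw [← real_inner_self_eq_norm_sq] at hS hww d1
  rw [← real_inner_self_eq_norm_sq w, ← real_inner_self_eq_norm_sq u, ← real_inner_self_eq_norm_sq q]
  simp only [inner_sub_left, inner_sub_right, inner_add_left, inner_neg_left,
    inner_neg_right, inner_smul_left, inner_smul_right, conj_trivial] at v1 v2 d1 hS ⊢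
  rw [real_inner_comm w u, real_inner_comm q w, real_inner_comm q u] at hS
  rw [real_inner_comm w u] at v1
  obtain ⟨r, hr⟩ : ∃ r, r = 1 / γ := ⟨_, rfl⟩
  have hr1 : r * γ = 1 := by rw [hr]; field_simp
  have hr2 : 1 / (2 * γ) = r / 2 := by rw [hr]; field_simp
  rw [hr2]
  rw [← hr] at v1 v2 hS ⊢
  -- The inner products become independent real variables. Once `k1`–`k4` have used `r γ = 1`, the
  -- claim is linear in the hypotheses.
  clear_value g y p
  clear hr hr2 hG e1 e2 e3 e4
  generalize ⟪w, u⟫ = wu at *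
  generalize ⟪w, w⟫ = ww at *
  generalize ⟪u, u⟫ = uu at *
  generalize ⟪q, q⟫ = qq at *
  generalize ⟪q, w⟫ = qw at *
  generalize ⟪q, u⟫ = qu at *
  generalize ⟪g, u⟫ = gu at *
  generalize ⟪g, w⟫ = gw at *
  have k1 : (1 / 2 - L * γ) * γ * (r ^ 2 * ww) = r / 2 * ww - L * ww := by
    linear_combination ((1 / 2 - L * γ) * ww * r - L * ww) * hr1
  have k2 : r * (-(γ * (qw + gw) - γ * (qu + gu))) = -((qw + gw) - (qu + gu)) := by
    linear_combination (-((qw + gw) - (qu + gu))) * hr1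
  have k3 : r * (γ * gw) = gw := by linear_combination gw * hr1
  have k4 : r / 2 * (- 2 * γ * (qw - qu) + γ ^ 2 * qq) = -(qw - qu) + γ / 2 * qq := by
    linear_combination (-(qw - qu) + γ * qq / 2) * hr1
  rw [k1]
  linarith

/-! ### Columns of a Haar-distributed orthogonal matrix -/

theorem dir_apply {d : ℕ} (G : O d) (j p : Fin d) : dir G j p = G.1 p j := by
  simp [dir, e, Matrix.toLpLin_apply]

theorem sum_col_mul_col {d : ℕ} (G : O d) (j k : Fin d) :
    ∑ p, G.1 p j * G.1 p k = if j = k then 1 else 0 := by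
  have h := (Matrix.mem_orthogonalGroup_iff' (Fin d) ℝ).1 G.2
  have h2 := congrFun (congrFun h j) k
  simpa [Matrix.mul_apply, Matrix.one_apply] using h2

theorem inner_dir {d : ℕ} (G : O d) (j k : Fin d) :
    ⟪dir G j, dir G k⟫ = if j = k then 1 else 0 := by
  rw [← sum_col_mul_col G j k, PiLp.inner_apply]
  simp [dir_apply, mul_comm]

theorem norm_dir {d : ℕ} (G : O d) (j : Fin d) : ‖dir G j‖ = 1 := by
  have h := inner_dir G j j
  rw [real_inner_self_eq_norm_sq, if_pos rfl] at h
  exact (pow_eq_one_iff_of_nonneg (norm_nonneg _) two_ne_zero).1 h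

theorem abs_entry_le_one {d : ℕ} (G : O d) (p j : Fin d) : |G.1 p j| ≤ 1 := by
  rw [← dir_apply, ← norm_dir G j]
  exact PiLp.norm_apply_le (dir G j) p

theorem measurable_entry {d : ℕ} (p j : Fin d) : Measurable fun G : O d => G.1 p j := by
  have : Continuous fun G : O d => G.1 p j := by
    have h : Continuous fun G : O d => (G.1 : Matrix (Fin d) (Fin d) ℝ) := continuous_subtype_val
    exact h.matrix_elem p j
  exact this.measurable

theorem measurable_dir {d : ℕ} (j : Fin d) : Measurable fun G : O d => dir G j := by
  have : (fun G : O d => dir G j) = fun G => WithLp.toLp 2 (fun p => G.1 p j) := by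
    funext G; ext p; exact dir_apply G j p
  rw [this]
  exact (WithLp.measurable_toLp 2 _).comp (measurable_pi_lambda _ fun p => measurable_entry p j)

theorem integrable_entry_mul_entry {d : ℕ} (ν : Measure (O d)) [IsFiniteMeasure ν]
    (p q j : Fin d) : Integrable (fun G : O d => G.1 p j * G.1 q j) ν := by
  refine Integrable.of_bound ((measurable_entry p j).mul (measurable_entry q j)).aestronglyMeasurable
    1 (ae_of_all _ fun G => ?_)
  rw [Real.norm_eq_abs, abs_mul]
  exact mul_le_one₀ (abs_entry_le_one G p j) (abs_nonneg _) (abs_entry_le_one G q j)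

/-- The reflection of the `p`-th coordinate. -/
def reflect {d : ℕ} (p : Fin d) : O d :=
  ⟨Matrix.diagonal fun k => if k = p then -1 else 1, by
    rw [Matrix.mem_orthogonalGroup_iff, Matrix.diagonal_transpose, Matrix.diagonal_mul_diagonal,
      ← Matrix.diagonal_one]
    congr 1
    funext k
    split_ifs <;> norm_num⟩

/-- The permutation matrix that exchanges two coordinates. -/
def exchange {d : ℕ} (p q : Fin d) : O d :=
  ⟨(Equiv.swap p q).permMatrix ℝ, by
    rw [Matrix.mem_orthogonalGroup_iff, Matrix.transpose_permMatrix, ← Matrix.permMatrix_mul]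
    simp⟩

theorem reflect_mul_apply {d : ℕ} (p : Fin d) (G : O d) (k j : Fin d) :
    (reflect p * G).1 k j = (if k = p then -1 else 1) * G.1 k j := by
  simp [reflect, Matrix.diagonal_mul]

theorem exchange_mul_apply {d : ℕ} (p q : Fin d) (G : O d) (k j : Fin d) :
    (exchange p q * G).1 k j = G.1 (Equiv.swap p q k) j := by
  simp [exchange, Matrix.mul_apply, PEquiv.toMatrix_apply]

/-- Left multiplication acts on rows. Flipping the sign of row `p` changes the sign of the integral
when `p ≠ q`, so it is zero; exchanging rows makes the diagonal integrals equal, and they sum to 1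
because columns are unit vectors. -/
theorem integral_entry_mul_entry {d : ℕ} (ν : Measure (O d)) [IsProbabilityMeasure ν]
    [ν.IsMulLeftInvariant] (p q j : Fin d) :
    ∫ G : O d, G.1 p j * G.1 q j ∂ν = if p = q then 1 / (d : ℝ) else 0 := by
  split_ifs with hpq
  · subst hpq
    have hsame : ∀ q : Fin d, ∫ G : O d, G.1 q j * G.1 q j ∂ν = ∫ G : O d, G.1 p j * G.1 p j ∂ν := by
      intro q
      rw [← integral_mul_left_eq_self _ (exchange p q)]
      simp only [exchange_mul_apply, Equiv.swap_apply_right]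
    have hsum : ∑ q : Fin d, ∫ G : O d, G.1 q j * G.1 q j ∂ν = 1 := by
      rw [← integral_finsetSum _ fun q _ => integrable_entry_mul_entry ν q q j]
      simp [sum_col_mul_col]
    simp only [hsame, Finset.sum_const, Finset.card_univ, Fintype.card_fin, nsmul_eq_mul] at hsum
    exact eq_one_div_of_mul_eq_one_right hsum
  · have h := integral_mul_left_eq_self (μ := ν) (fun G : O d => G.1 p j * G.1 q j) (reflect p)
    simp only [reflect_mul_apply, if_pos, if_neg (Ne.symm hpq)] at h
    have h2 : ∫ G : O d, -1 * G.1 p j * (1 * G.1 q j) ∂ν = -∫ G : O d, G.1 p j * G.1 q j ∂ν := by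
      rw [← integral_neg]; congr 1; funext G; ring
    linarith

theorem integrable_inner_dir_smul {d : ℕ} (ν : Measure (O d)) [IsFiniteMeasure ν]
    (a : E d) (j : Fin d) : Integrable (fun G : O d => ⟪a, dir G j⟫ • dir G j) ν := by
  refine Integrable.of_bound (C := ‖a‖) ?_ (ae_of_all _ fun G => ?_)
  · have := measurable_dir (d := d) j
    exact ((Measurable.inner (𝕜 := ℝ) measurable_const this).smul this).aestronglyMeasurable
  · rw [norm_smul, norm_dir, mul_one]
    have h1 := norm_inner_le_norm (𝕜 := ℝ) a (dir G j)
    rwa [norm_dir, mul_one] at h1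

/-- `𝔼 ⟨a, G e_j⟩ (G e_j)_p = a_p / d`. -/
theorem integral_inner_dir_mul {d : ℕ} (ν : Measure (O d)) [IsProbabilityMeasure ν]
    [ν.IsMulLeftInvariant] (a : E d) (j p : Fin d) :
    ∫ G : O d, ⟪a, dir G j⟫ * dir G j p ∂ν = a p / d := by
  have : ∀ G : O d, ⟪a, dir G j⟫ * dir G j p = ∑ q, a q * (G.1 q j * G.1 p j) := by
    intro G
    rw [PiLp.inner_apply, Finset.sum_mul]
    refine Finset.sum_congr rfl fun q _ => ?_
    simp only [dir_apply, RCLike.inner_apply, conj_trivial]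
    ring
  simp_rw [this]
  rw [integral_finsetSum _ fun q _ => (integrable_entry_mul_entry ν q p j).const_mul _]
  simp_rw [integral_const_mul, integral_entry_mul_entry]
  simp [div_eq_mul_inv]

theorem integral_euclidean_apply {Ω : Type*} [MeasurableSpace Ω] {P : Measure Ω} {d : ℕ}
    {Y : Ω → E d} (hY : Integrable Y P) (p : Fin d) : (∫ ω, Y ω ∂P) p = ∫ ω, Y ω p ∂P :=
  (ContinuousLinearMap.integral_comp_comm
    (EuclideanSpace.proj p : EuclideanSpace ℝ (Fin d) →L[ℝ] ℝ) hY).symm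

theorem integral_inner_dir_smul {d : ℕ} (ν : Measure (O d)) [IsProbabilityMeasure ν]
    [ν.IsMulLeftInvariant] (a : E d) (j : Fin d) :
    ∫ G : O d, ⟪a, dir G j⟫ • dir G j ∂ν = (1 / (d : ℝ)) • a := by
  ext p
  rw [integral_euclidean_apply (integrable_inner_dir_smul ν a j)]
  simp only [PiLp.smul_apply, smul_eq_mul, integral_inner_dir_mul]
  ring

theorem integral_inner_dir_sq {d : ℕ} (ν : Measure (O d)) [IsProbabilityMeasure ν]
    [ν.IsMulLeftInvariant] (a : E d) (j : Fin d) :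
    ∫ G : O d, ⟪a, dir G j⟫ ^ 2 ∂ν = ‖a‖ ^ 2 / d := by
  have hsq : ∀ G : O d, ⟪a, dir G j⟫ ^ 2 = ⟪a, ⟪a, dir G j⟫ • dir G j⟫ := by
    intro G
    rw [inner_smul_right, sq]
  simp_rw [hsq]
  rw [integral_inner (integrable_inner_dir_smul ν a j), integral_inner_dir_smul,
    inner_smul_right, real_inner_self_eq_norm_sq]
  ring

/-! ### Pointwise errors and measurability of the finite differences -/

theorem IsSmoothWith.abs_quotient_sub_inner_le {d : ℕ} {L : ℝ} {φ : E d → ℝ}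
    (hφ : IsSmoothWith L φ) {β : ℝ} (hβ : 0 < β) (x : E d) {u : E d} (hu : ‖u‖ = 1) :
    |(φ (x + β • u) - φ x) / β - ⟪gradient φ x, u⟫| ≤ L * β / 2 := by
  have h := hφ.abs_sub_sub_inner_le x (β • u)
  rw [norm_smul, hu, mul_one, Real.norm_of_nonneg hβ.le, inner_smul_right] at h
  have e1 : (φ (x + β • u) - φ x) / β - ⟪gradient φ x, u⟫
      = (φ (x + β • u) - φ x - β * ⟪gradient φ x, u⟫) / β := by field_simp
  rw [e1, abs_div, abs_of_pos hβ, div_le_iff₀ hβ]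
  linarith

theorem fullApprox_apply {d : ℕ} (φ : E d → ℝ) (x : E d) (β : ℝ) (p : Fin d) :
    fullApprox φ x β p = (φ (x + β • e p) - φ x) / β := by
  simp [fullApprox, e, Finset.sum_apply, Pi.single_apply]

theorem IsSmoothWith.norm_fullApprox_sub_gradient_sq_le {d : ℕ} {L : ℝ} {φ : E d → ℝ}
    (hφ : IsSmoothWith L φ) {β : ℝ} (hβ : 0 < β) (x : E d) :
    ‖fullApprox φ x β - gradient φ x‖ ^ 2 ≤ d * (L * β / 2) ^ 2 := by
  rw [EuclideanSpace.norm_sq_eq]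
  have : ∀ p ∈ (Finset.univ : Finset (Fin d)),
      ‖(fullApprox φ x β - gradient φ x) p‖ ^ 2 ≤ (L * β / 2) ^ 2 := by
    intro p _
    have h := hφ.abs_quotient_sub_inner_le hβ x (u := e p) (by simp [e])
    have hin : ⟪gradient φ x, e p⟫ = gradient φ x p := by
      rw [e, EuclideanSpace.inner_single_right]
      simp
    rw [PiLp.sub_apply, fullApprox_apply, ← hin, Real.norm_eq_abs]
    exact pow_le_pow_left₀ (abs_nonneg _) h 2
  refine (Finset.sum_le_sum this).trans ?_
  simp

/-- The directions used by `structApprox`. -/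
abbrev cols (d ℓ : ℕ) : Finset (Fin d) := Finset.univ.filter (fun j : Fin d => (j : ℕ) < ℓ)

theorem card_cols {d ℓ : ℕ} (h : ℓ ≤ d) : (cols d ℓ).card = ℓ := by
  rw [cols, Fin.card_filter_val_lt, min_eq_right h]

/-- The difference of the finite difference quotients of `φ` at `x` and `x₀`. -/
def diffQuot {d : ℕ} (φ : E d → ℝ) (β : ℝ) (x₀ x u : E d) : ℝ :=
  (φ (x + β • u) - φ x) / β - (φ (x₀ + β • u) - φ x₀) / β

theorem structApprox_sub {d ℓ : ℕ} (φ : E d → ℝ) (β : ℝ) (x₀ x : E d) (G : O d) :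
    structApprox ℓ φ x G β - structApprox ℓ φ x₀ G β
      = ((d : ℝ) / (ℓ : ℝ)) • ∑ j ∈ cols d ℓ, diffQuot φ β x₀ x (dir G j) • dir G j := by
  rw [structApprox, structApprox, ← smul_sub, ← Finset.sum_sub_distrib]
  simp only [← sub_smul, diffQuot]

theorem IsSmoothWith.abs_diffQuot_sub_inner_le {d : ℕ} {L : ℝ} {φ : E d → ℝ}
    (hφ : IsSmoothWith L φ) {β : ℝ} (hβ : 0 < β) (x₀ x : E d) {u : E d} (hu : ‖u‖ = 1) :
    |diffQuot φ β x₀ x u - ⟪gradient φ x - gradient φ x₀, u⟫| ≤ L * β := by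
  have h1 := abs_le.1 (hφ.abs_quotient_sub_inner_le hβ x hu)
  have h2 := abs_le.1 (hφ.abs_quotient_sub_inner_le hβ x₀ hu)
  rw [inner_sub_left, diffQuot, abs_le]
  constructor <;> linarith

/-- Pythagoras for the orthonormal columns. For general unit directions, Cauchy–Schwarz would cost
an extra factor `S.card`. -/
theorem norm_sum_smul_dir_sq {d : ℕ} (S : Finset (Fin d)) (c : Fin d → ℝ) (G : O d) :
    ‖∑ j ∈ S, c j • dir G j‖ ^ 2 = ∑ j ∈ S, c j ^ 2 := by
  rw [← real_inner_self_eq_norm_sq, sum_inner]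
  refine Finset.sum_congr rfl fun j hj => ?_
  rw [inner_sum]
  simp only [inner_smul_left, inner_smul_right, inner_dir, conj_trivial]
  simp [hj, sq]

theorem IsSmoothWith.norm_structApprox_sub_sq_le {d ℓ : ℕ} {L : ℝ} {φ : E d → ℝ}
    (hφ : IsSmoothWith L φ) {β : ℝ} (hβ : 0 < β) (x₀ x : E d) (G : O d) :
    ‖structApprox ℓ φ x G β - structApprox ℓ φ x₀ G β‖ ^ 2 ≤ ((d : ℝ) / ℓ) ^ 2 *
      ∑ j ∈ cols d ℓ, (2 * ⟪gradient φ x - gradient φ x₀, dir G j⟫ ^ 2 + 2 * (L * β) ^ 2) := by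
  rw [structApprox_sub, norm_smul, mul_pow, norm_sum_smul_dir_sq, Real.norm_of_nonneg (by positivity)]
  gcongr with j hj
  have h := hφ.abs_diffQuot_sub_inner_le hβ x₀ x (norm_dir G j)
  have h2 := sq_le_sq' (by linarith [neg_le_of_abs_le h]) (le_of_abs_le h)
  -- With `q` the quotient and `a` the inner product, `2a² + 2(q - a)² - q² = (q - 2a)²`.
  nlinarith [sq_nonneg (diffQuot φ β x₀ x (dir G j)
    - 2 * ⟪gradient φ x - gradient φ x₀, dir G j⟫)]

/-- A crude bound, uniform in `G`. It serves integrability and boundedness of the iterates; the rate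
comes from the second moment. -/
theorem IsSmoothWith.norm_structApprox_sub_le {d ℓ : ℕ} (hℓ : 1 ≤ ℓ) (hℓd : ℓ ≤ d)
    {L : ℝ} {φ : E d → ℝ} (hφ : IsSmoothWith L φ) {β : ℝ} (hβ : 0 < β) (x₀ x : E d) (G : O d) :
    ‖structApprox ℓ φ x G β - structApprox ℓ φ x₀ G β‖ ≤ d * (L * ‖x - x₀‖ + L * β) := by
  have hℓ' : (0 : ℝ) < ℓ := by exact_mod_cast hℓ
  rw [structApprox_sub, norm_smul, Real.norm_of_nonneg (by positivity)]
  have h1 : ‖∑ j ∈ cols d ℓ, diffQuot φ β x₀ x (dir G j) • dir G j‖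
      ≤ ∑ j ∈ cols d ℓ, (L * ‖x - x₀‖ + L * β) := by
    refine norm_sum_le_of_le _ fun j _ => ?_
    rw [norm_smul, norm_dir, mul_one, Real.norm_eq_abs]
    have h2 := hφ.abs_diffQuot_sub_inner_le hβ x₀ x (norm_dir G j)
    have h3 := abs_real_inner_le_norm (gradient φ x - gradient φ x₀) (dir G j)
    rw [norm_dir, mul_one] at h3
    have h4 := abs_sub_abs_le_abs_sub (diffQuot φ β x₀ x (dir G j))
      ⟪gradient φ x - gradient φ x₀, dir G j⟫
    linarith [hφ.2 x x₀]
  rw [Finset.sum_const, card_cols hℓd, nsmul_eq_mul] at h1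
  calc _ ≤ (d : ℝ) / ℓ * (ℓ * (L * ‖x - x₀‖ + L * β)) := by gcongr
    _ = _ := by field_simp

theorem measurable_structApprox {Ω : Type*} [MeasurableSpace Ω] {d ℓ : ℕ} {φ : E d → ℝ}
    (hφ : Continuous φ) (β : ℝ) {x : Ω → E d} (hx : Measurable x) {G : Ω → O d}
    (hG : Measurable G) : Measurable fun ω => structApprox ℓ φ (x ω) (G ω) β := by
  unfold structApprox
  refine Measurable.const_smul (M := ℝ) (Finset.measurable_sum (M := E d) _ fun j _ => ?_) _
  have h1 : Measurable fun ω => dir (G ω) j := (measurable_dir j).comp hG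
  have h2 : Measurable fun ω => x ω + β • dir (G ω) j := hx.add (h1.const_smul β)
  exact (((hφ.measurable.comp h2).sub (hφ.measurable.comp hx)).div_const β).smul h1

theorem measurable_index_apply {Ω : Type*} [MeasurableSpace Ω] {n : ℕ} {V : Type*}
    [MeasurableSpace V] (F : Fin n → Ω → V) (hF : ∀ k, Measurable (F k)) {i : Ω → Fin n}
    (hi : Measurable i) : Measurable fun ω => F (i ω) ω := by
  have h : Measurable (Function.uncurry F) := measurable_from_prod_countable_right hF
  exact h.comp (hi.prodMk measurable_id)

theorem measurable_structApprox_sub {Ω : Type*} [MeasurableSpace Ω] {d ℓ n : ℕ}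
    {f : Fin n → E d → ℝ} (hf : ∀ i, Continuous (f i)) (β : ℝ) {x₀ x : Ω → E d}
    (hx₀ : Measurable x₀) (hx : Measurable x) {i : Ω → Fin n} (hi : Measurable i) {G : Ω → O d}
    (hG : Measurable G) :
    Measurable fun ω => structApprox ℓ (f (i ω)) (x ω) (G ω) β
      - structApprox ℓ (f (i ω)) (x₀ ω) (G ω) β := by
  refine measurable_index_apply (fun (k : Fin n) (ω : Ω) =>
      structApprox ℓ (f k) (x ω) (G ω) β - structApprox ℓ (f k) (x₀ ω) (G ω) β) (fun k => ?_) hi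
  have h1 := measurable_structApprox (ℓ := ℓ) (hf k) β hx hG
  have h2 := measurable_structApprox (ℓ := ℓ) (hf k) β hx₀ hG
  exact h1.sub h2

/-! ### Moments of the structured estimator for one function -/

/-- The factor `(d/ℓ)²` meets `ℓ` terms, each of mean `2‖a‖²/d + 2(Lβ)²` by isotropy. The `1/d` is
what keeps the dependence on `‖x - x₀‖` linear in `d`. -/
theorem IsSmoothWith.integral_norm_structApprox_sub_sq_le {d ℓ : ℕ} (hℓ : 1 ≤ ℓ) (hℓd : ℓ ≤ d)
    (ν : Measure (O d)) [IsProbabilityMeasure ν] [ν.IsMulLeftInvariant]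
    {L : ℝ} {φ : E d → ℝ} (hφ : IsSmoothWith L φ) {β : ℝ} (hβ : 0 < β)
    (x₀ x : E d) :
    ∫ G, ‖structApprox ℓ φ x G β - structApprox ℓ φ x₀ G β‖ ^ 2 ∂ν
      ≤ 2 * d / ℓ * (L * ‖x - x₀‖) ^ 2 + 2 * d ^ 2 / ℓ * (L * β) ^ 2 := by
  have hℓ' : (0 : ℝ) < ℓ := by exact_mod_cast hℓ
  have hd' : (0 : ℝ) < d := by exact_mod_cast hℓ.trans hℓd
  set a := gradient φ x - gradient φ x₀ with ha
  have hint : ∀ j, Integrable (fun G : O d => ⟪a, dir G j⟫ ^ 2) ν := by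
    intro j
    have := (integrable_inner_dir_smul ν a j).const_inner (𝕜 := ℝ) a
    simpa only [inner_smul_right, ← sq] using this
  have hint2 : ∀ j ∈ cols d ℓ,
      Integrable (fun G : O d => 2 * ⟪a, dir G j⟫ ^ 2 + 2 * (L * β) ^ 2) ν :=
    fun j _ => ((hint j).const_mul 2).add (integrable_const _)
  calc ∫ G, ‖structApprox ℓ φ x G β - structApprox ℓ φ x₀ G β‖ ^ 2 ∂ν
      ≤ ∫ G, ((d : ℝ) / ℓ) ^ 2 *
        ∑ j ∈ cols d ℓ, (2 * ⟪a, dir G j⟫ ^ 2 + 2 * (L * β) ^ 2) ∂ν := by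
        refine integral_mono_of_nonneg (ae_of_all _ fun G => by positivity)
          ((integrable_finsetSum _ hint2).const_mul _)
          (ae_of_all _ fun G => hφ.norm_structApprox_sub_sq_le hβ x₀ x G)
    _ = 2 * d / ℓ * ‖a‖ ^ 2 + 2 * d ^ 2 / ℓ * (L * β) ^ 2 := by
        rw [integral_const_mul, integral_finsetSum _ hint2]
        simp_rw [integral_add ((hint _).const_mul 2) (integrable_const _), integral_const_mul,
          integral_inner_dir_sq]
        simp only [integral_const, probReal_univ, smul_eq_mul, one_mul, Finset.sum_const,
          card_cols hℓd, nsmul_eq_mul]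
        field_simp
    _ ≤ _ := by
        gcongr
        exact hφ.2 x x₀

theorem IsSmoothWith.norm_integral_structApprox_sub_le {d ℓ : ℕ} (hℓ : 1 ≤ ℓ) (hℓd : ℓ ≤ d)
    (ν : Measure (O d)) [IsProbabilityMeasure ν] [ν.IsMulLeftInvariant]
    {L : ℝ} {φ : E d → ℝ} (hφ : IsSmoothWith L φ) {β : ℝ} (hβ : 0 < β)
    (x₀ x : E d) :
    ‖∫ G, (structApprox ℓ φ x G β - structApprox ℓ φ x₀ G β) ∂ν
      - (gradient φ x - gradient φ x₀)‖ ≤ d * (L * β) := by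
  have hℓ' : (0 : ℝ) < ℓ := by exact_mod_cast hℓ
  have hd' : (0 : ℝ) < d := by exact_mod_cast hℓ.trans hℓd
  set a := gradient φ x - gradient φ x₀ with ha
  -- Replacing the quotients by inner products gives an exactly unbiased estimator of `a`, as `(d/ℓ)
  -- · ℓ · (1/d) = 1`. The bias is then at most the pointwise replacement error, `(d/ℓ) · ℓ · Lβ`.
  have hint : Integrable (fun G : O d =>
      ((d : ℝ) / ℓ) • ∑ j ∈ cols d ℓ, ⟪a, dir G j⟫ • dir G j) ν :=
    Integrable.smul ((d : ℝ) / ℓ) (f := fun G : O d => ∑ j ∈ cols d ℓ, ⟪a, dir G j⟫ • dir G j)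
      (integrable_finsetSum _ fun j _ => integrable_inner_dir_smul ν a j)
  have hmean : ∫ G : O d, ((d : ℝ) / ℓ) • ∑ j ∈ cols d ℓ, ⟪a, dir G j⟫ • dir G j ∂ν = a := by
    rw [integral_smul, integral_finsetSum _ fun j _ => integrable_inner_dir_smul ν a j]
    simp_rw [integral_inner_dir_smul]
    rw [Finset.sum_const, card_cols hℓd, ← Nat.cast_smul_eq_nsmul ℝ, smul_smul, smul_smul]
    have : (d : ℝ) / ℓ * (ℓ * (1 / d)) = 1 := by field_simp
    rw [← mul_assoc] at this
    rw [this, one_smul]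
  have hint2 : Integrable (fun G : O d =>
      structApprox ℓ φ x G β - structApprox ℓ φ x₀ G β) ν :=
    Integrable.of_bound ((measurable_structApprox hφ.1.continuous β measurable_const measurable_id).sub
      (measurable_structApprox hφ.1.continuous β measurable_const measurable_id)).aestronglyMeasurable _
      (ae_of_all _ fun G => hφ.norm_structApprox_sub_le hℓ hℓd hβ x₀ x G)
  rw [← hmean, ← integral_sub hint2 hint]
  refine (norm_integral_le_of_norm_le_const (C := d * (L * β)) (ae_of_all _ fun G => ?_)).trans
    (by simp)
  rw [structApprox_sub, ← smul_sub, ← Finset.sum_sub_distrib, norm_smul,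
    Real.norm_of_nonneg (by positivity)]
  have h1 : ‖∑ j ∈ cols d ℓ, (diffQuot φ β x₀ x (dir G j) • dir G j - ⟪a, dir G j⟫ • dir G j)‖
      ≤ ∑ j ∈ cols d ℓ, L * β := by
    refine norm_sum_le_of_le _ fun j _ => ?_
    rw [← sub_smul, norm_smul, norm_dir, mul_one, Real.norm_eq_abs]
    exact hφ.abs_diffQuot_sub_inner_le hβ x₀ x (norm_dir G j)
  rw [Finset.sum_const, card_cols hℓd, nsmul_eq_mul] at h1
  calc _ ≤ (d : ℝ) / ℓ * (ℓ * (L * β)) := by gcongr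
    _ = _ := by field_simp

/-! ### Averaging over the index, the matrix and the minibatch -/

theorem integral_uniformOn_univ {n : ℕ} (hn : 0 < n) {V : Type*} [NormedAddCommGroup V]
    [NormedSpace ℝ V] [CompleteSpace V] (φ : Fin n → V) :
    ∫ i, φ i ∂(uniformOn (Set.univ : Set (Fin n))) = (1 / (n : ℝ)) • ∑ i, φ i := by
  have : Nonempty (Fin n) := ⟨⟨0, hn⟩⟩
  rw [integral_fintype (Integrable.of_finite), Finset.smul_sum]
  refine Finset.sum_congr rfl fun i _ => ?_
  congr 1
  rw [measureReal_def, uniformOn_univ]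
  simp

/-- The second moment of a shifted average of pairwise independent bounded random vectors. -/
theorem integral_norm_average_add_sq_le {Ω : Type*} [MeasurableSpace Ω] (P : Measure Ω)
    [IsProbabilityMeasure P] {d b : ℕ} (Y : Fin b → Ω → E d) (hY : ∀ j, Measurable (Y j)) (C : ℝ)
    (hC : ∀ j ω, ‖Y j ω‖ ≤ C) (hind : Pairwise fun j k => IndepFun (Y j) (Y k) P) (c : E d) :
    ∫ ω, ‖(1 / (b : ℝ)) • ∑ j, Y j ω + c‖ ^ 2 ∂P
      ≤ (1 / (b : ℝ)) ^ 2 * ∑ j, ∫ ω, ‖Y j ω‖ ^ 2 ∂P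
        + ‖(1 / (b : ℝ)) • ∑ j, ∫ ω, Y j ω ∂P + c‖ ^ 2 := by
  have hYp : ∀ j p, Measurable fun ω => Y j ω p := fun j p =>
    (EuclideanSpace.proj p : EuclideanSpace ℝ (Fin d) →L[ℝ] ℝ).continuous.measurable.comp (hY j)
  have hCp : ∀ j p ω, ‖Y j ω p‖ ≤ C := fun j p ω =>
    (PiLp.norm_apply_le (Y j ω) p).trans (hC j ω)
  have hmem : ∀ j p, MemLp (fun ω => Y j ω p) 2 P := fun j p =>
    MemLp.of_bound (hYp j p).aestronglyMeasurable C (ae_of_all _ (hCp j p))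
  have hYint : ∀ j, Integrable (Y j) P := fun j =>
    Integrable.of_bound (hY j).aestronglyMeasurable C (ae_of_all _ (hC j))
  have hmean : ∀ j p, (∫ ω, Y j ω ∂P) p = ∫ ω, Y j ω p ∂P := fun j p =>
    integral_euclidean_apply (hYint j) p
  have hcoord : ∀ p, ∫ ω, ((1 / (b : ℝ)) * ∑ j, Y j ω p + c p) ^ 2 ∂P
      ≤ (1 / (b : ℝ)) ^ 2 * ∑ j, ∫ ω, (Y j ω p) ^ 2 ∂P
        + ((1 / (b : ℝ)) * ∑ j, ∫ ω, Y j ω p ∂P + c p) ^ 2 := by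
    intro p
    have hS : MemLp (∑ j, fun ω => Y j ω p) 2 P := memLp_finsetSum' _ fun j _ => hmem j p
    have hS' : MemLp (fun ω => (1 / (b : ℝ)) * (∑ j, fun ω => Y j ω p) ω) 2 P := hS.const_mul _
    have hZ : MemLp (fun ω => (1 / (b : ℝ)) * (∑ j, fun ω => Y j ω p) ω + c p) 2 P :=
      hS'.add (memLp_const _)
    -- In each coordinate the second moment is the variance plus the squared mean. The shift `c p`
    -- leaves the variance unchanged, variances of independent terms add, and each is at most a
    -- second moment.
    have hvar := variance_eq_sub hZ
    rw [variance_add_const hS'.aestronglyMeasurable, variance_const_mul,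
      IndepFun.variance_sum (fun j _ => hmem j p) (fun j _ k _ hjk => by
        have m := (EuclideanSpace.proj p : EuclideanSpace ℝ (Fin d) →L[ℝ] ℝ).continuous.measurable
        exact (hind hjk).comp m m)] at hvar
    have hv : ∑ j, Var[fun ω => Y j ω p; P] ≤ ∑ j, ∫ ω, (Y j ω p) ^ 2 ∂P :=
      Finset.sum_le_sum fun j _ => variance_le_expectation_sq (hYp j p).aestronglyMeasurable
    have hE : ∫ ω, ((1 / (b : ℝ)) * (∑ j, fun ω => Y j ω p) ω + c p) ∂P
        = (1 / (b : ℝ)) * ∑ j, ∫ ω, Y j ω p ∂P + c p := by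
      rw [integral_add (hS'.integrable one_le_two) (integrable_const _), integral_const_mul]
      simp only [Finset.sum_apply]
      rw [integral_finsetSum _ fun j _ => (hmem j p).integrable one_le_two]
      simp
    rw [hE] at hvar
    simp only [Pi.pow_apply, Finset.sum_apply] at hvar
    have := mul_le_mul_of_nonneg_left hv (sq_nonneg (1 / (b : ℝ)))
    linarith
  have hsqint : ∀ j p, Integrable (fun ω => (Y j ω p) ^ 2) P := fun j p => (hmem j p).integrable_sq
  simp only [EuclideanSpace.norm_sq_eq, Real.norm_eq_abs, sq_abs, PiLp.add_apply,
    PiLp.smul_apply, smul_eq_mul, WithLp.ofLp_sum, Finset.sum_apply]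
  rw [integral_finsetSum]
  · simp_rw [integral_finsetSum _ fun p _ => hsqint _ p]
    rw [Finset.sum_comm, Finset.mul_sum, ← Finset.sum_add_distrib]
    refine Finset.sum_le_sum fun p _ => ?_
    simpa only [hmean] using hcoord p
  · intro p _
    have hS' : MemLp (fun ω => (1 / (b : ℝ)) * ∑ j, Y j ω p + c p) 2 P :=
      ((memLp_finsetSum _ fun j _ => hmem j p).const_mul _).add (memLp_const _)
    exact hS'.integrable_sq

section Sample

variable {Ω : Type*} [MeasurableSpace Ω] {P : Measure Ω} [IsProbabilityMeasure P] {d n ℓ : ℕ}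
  {L : ℝ} {f : Fin n → E d → ℝ} {β : ℝ} {i : Ω → Fin n} {G : Ω → O d}

theorem integral_sample {V : Type*} [NormedAddCommGroup V] [NormedSpace ℝ V] [CompleteSpace V]
    (hn : 0 < n) (hi : Measurable i) (hG : Measurable G)
    (law_i : P.map i = uniformOn (Set.univ : Set (Fin n)))
    (hind : IndepFun i G P) (ψ : Fin n → O d → V)
    (hψ : StronglyMeasurable (Function.uncurry ψ)) (C : ℝ) (hC : ∀ k g, ‖ψ k g‖ ≤ C) :
    ∫ ω, ψ (i ω) (G ω) ∂P = (1 / (n : ℝ)) • ∑ k, ∫ g, ψ k g ∂(P.map G) := by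
  have : Nonempty (Fin n) := ⟨⟨0, hn⟩⟩
  have : IsProbabilityMeasure (P.map G) := Measure.isProbabilityMeasure_map hG.aemeasurable
  have h := (indepFun_iff_map_prod_eq_prod_map_map hi.aemeasurable hG.aemeasurable).1 hind
  have h2 : ∫ ω, ψ (i ω) (G ω) ∂P
      = ∫ q, Function.uncurry ψ q ∂(P.map fun ω => (i ω, G ω)) :=
    (integral_map (hi.prodMk hG).aemeasurable hψ.aestronglyMeasurable).symm
  rw [h2, h, law_i, integral_prod, integral_uniformOn_univ hn]
  · rfl
  · exact Integrable.of_bound hψ.aestronglyMeasurable C (ae_of_all _ fun q => hC q.1 q.2)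

theorem average_le {n : ℕ} (hn : 0 < n) {a : Fin n → ℝ} {C : ℝ} (h : ∀ k, a k ≤ C) :
    (1 / (n : ℝ)) * ∑ k, a k ≤ C := by
  have hn' : (0 : ℝ) < n := by exact_mod_cast hn
  have h1 : ∑ k, a k ≤ n * C := by
    refine (Finset.sum_le_sum fun k _ => h k).trans ?_
    simp
  calc 1 / (n : ℝ) * ∑ k, a k ≤ 1 / (n : ℝ) * (n * C) := by gcongr
    _ = C := by field_simp

theorem norm_average_le {n : ℕ} (hn : 0 < n) {V : Type*} [NormedAddCommGroup V] [NormedSpace ℝ V]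
    {a : Fin n → V} {C : ℝ} (h : ∀ k, ‖a k‖ ≤ C) : ‖(1 / (n : ℝ)) • ∑ k, a k‖ ≤ C := by
  rw [norm_smul, Real.norm_of_nonneg (by positivity)]
  refine (mul_le_mul_of_nonneg_left (norm_sum_le _ _) (by positivity)).trans (average_le hn h)

theorem average_sub {n : ℕ} (hn : 0 < n) {V : Type*} [AddCommGroup V] [Module ℝ V]
    (a : Fin n → V) (c : V) :
    (1 / (n : ℝ)) • ∑ k, a k - c = (1 / (n : ℝ)) • ∑ k, (a k - c) := by
  have hn' : (n : ℝ) ≠ 0 := by exact_mod_cast hn.ne'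
  rw [Finset.sum_sub_distrib, smul_sub, Finset.sum_const, Finset.card_univ, Fintype.card_fin,
    ← Nat.cast_smul_eq_nsmul ℝ, smul_smul, one_div, inv_mul_cancel₀ hn', one_smul]

theorem stronglyMeasurable_uncurry_structApprox_sub (hf : ∀ k, IsSmoothWith L (f k)) (x₀ x : E d) :
    StronglyMeasurable (Function.uncurry fun (k : Fin n) (g : O d) =>
      structApprox ℓ (f k) x g β - structApprox ℓ (f k) x₀ g β) := by
  have h := measurable_structApprox_sub (ℓ := ℓ) (fun k => (hf k).1.continuous) β
    (x₀ := fun _ : Fin n × O d => x₀) (x := fun _ => x) measurable_const measurable_const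
    measurable_fst measurable_snd
  exact h.stronglyMeasurable

theorem integral_norm_sample_sq_le (hn : 0 < n) (hℓ : 1 ≤ ℓ) (hℓd : ℓ ≤ d)
    (hf : ∀ k, IsSmoothWith L (f k)) (hβ : 0 < β) (hi : Measurable i) (hG : Measurable G)
    (law_i : P.map i = uniformOn (Set.univ : Set (Fin n))) (law_G : (P.map G).IsHaarMeasure)
    (hind : IndepFun i G P) (x₀ x : E d) :
    ∫ ω, ‖structApprox ℓ (f (i ω)) x (G ω) β - structApprox ℓ (f (i ω)) x₀ (G ω) β‖ ^ 2 ∂P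
      ≤ 2 * d / ℓ * (L * ‖x - x₀‖) ^ 2 + 2 * d ^ 2 / ℓ * (L * β) ^ 2 := by
  have : IsProbabilityMeasure (P.map G) := Measure.isProbabilityMeasure_map hG.aemeasurable
  have h := integral_sample hn hi hG law_i hind
    (fun k g => ‖structApprox ℓ (f k) x g β - structApprox ℓ (f k) x₀ g β‖ ^ 2)
    (show StronglyMeasurable fun q : Fin n × O d =>
      ‖structApprox ℓ (f q.1) x q.2 β - structApprox ℓ (f q.1) x₀ q.2 β‖ ^ 2 from
      (stronglyMeasurable_uncurry_structApprox_sub hf x₀ x).norm.pow 2)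
    ((d * (L * ‖x - x₀‖ + L * β)) ^ 2) (fun k g => by
      rw [Real.norm_of_nonneg (by positivity)]
      gcongr
      exact (hf k).norm_structApprox_sub_le hℓ hℓd hβ x₀ x g)
  rw [h, smul_eq_mul]
  exact average_le hn fun k =>
    (hf k).integral_norm_structApprox_sub_sq_le hℓ hℓd (P.map G) hβ x₀ x

theorem norm_integral_sample_sub_le (hn : 0 < n) (hℓ : 1 ≤ ℓ) (hℓd : ℓ ≤ d)
    (hf : ∀ k, IsSmoothWith L (f k)) (hβ : 0 < β) (hi : Measurable i) (hG : Measurable G)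
    (law_i : P.map i = uniformOn (Set.univ : Set (Fin n))) (law_G : (P.map G).IsHaarMeasure)
    (hind : IndepFun i G P) (x₀ x : E d) :
    ‖∫ ω, (structApprox ℓ (f (i ω)) x (G ω) β - structApprox ℓ (f (i ω)) x₀ (G ω) β) ∂P
      - (gradient (avg f) x - gradient (avg f) x₀)‖ ≤ d * (L * β) := by
  have : IsProbabilityMeasure (P.map G) := Measure.isProbabilityMeasure_map hG.aemeasurable
  have h := integral_sample hn hi hG law_i hind
    (fun k g => structApprox ℓ (f k) x g β - structApprox ℓ (f k) x₀ g β)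
    (stronglyMeasurable_uncurry_structApprox_sub hf x₀ x)
    (d * (L * ‖x - x₀‖ + L * β))
    (fun k g => (hf k).norm_structApprox_sub_le hℓ hℓd hβ x₀ x g)
  rw [h, gradient_avg hf, gradient_avg hf, ← smul_sub, ← Finset.sum_sub_distrib, ← smul_sub,
    ← Finset.sum_sub_distrib]
  exact norm_average_le hn fun k =>
    (hf k).norm_integral_structApprox_sub_le hℓ hℓd (P.map G) hβ x₀ x

end Sample

/-- Mean squared error of the search direction, with the current iterate and the snapshot fixed. -/
theorem integral_norm_direction_sub_gradient_sq_le {Ω : Type*} [MeasurableSpace Ω] {P : Measure Ω}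
    [IsProbabilityMeasure P] {d n b ℓ : ℕ} (hn : 0 < n) (hb : 0 < b) (hℓ : 1 ≤ ℓ) (hℓd : ℓ ≤ d)
    {L : ℝ} {f : Fin n → E d → ℝ} (hf : ∀ k, IsSmoothWith L (f k)) {β : ℝ} (hβ : 0 < β)
    {i : Fin b → Ω → Fin n} {G : Fin b → Ω → O d}
    (hi : ∀ j, Measurable (i j)) (hG : ∀ j, Measurable (G j))
    (law_i : ∀ j, P.map (i j) = uniformOn (Set.univ : Set (Fin n)))
    (law_G : ∀ j, (P.map (G j)).IsHaarMeasure) (hpair : ∀ j, IndepFun (i j) (G j) P)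
    (hind : Pairwise fun j k =>
      IndepFun (fun ω => (i j ω, G j ω)) (fun ω => (i k ω, G k ω)) P) (x₀ x : E d) :
    ∫ ω, ‖direction ℓ f β x₀ x (fun j => i j ω) (fun j => G j ω) - gradient (avg f) x‖ ^ 2 ∂P
      ≤ 2 * d / (ℓ * b) * (L * ‖x - x₀‖) ^ 2
        + (2 * d / (ℓ * b) + 2 * d + 1 / 2) * (d * (L * β) ^ 2) := by
  have hb' : (0 : ℝ) < b := by exact_mod_cast hb
  have hℓ' : (0 : ℝ) < ℓ := by exact_mod_cast hℓ
  -- All terms are one measurable function `D` of the pairs `(i j, G j)`, so independence passes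
  -- from the pairs to the `Y j`.
  obtain ⟨D, hD⟩ : ∃ D : Fin n × O d → E d, D = fun q =>
    structApprox ℓ (f q.1) x q.2 β - structApprox ℓ (f q.1) x₀ q.2 β := ⟨_, rfl⟩
  have hDm : Measurable D := by
    rw [hD]
    exact (stronglyMeasurable_uncurry_structApprox_sub hf x₀ x).measurable
  have hDb : ∀ q, ‖D q‖ ≤ d * (L * ‖x - x₀‖ + L * β) := by
    intro q
    rw [hD]
    exact (hf _).norm_structApprox_sub_le hℓ hℓd hβ x₀ x _
  have hDsq : ∀ j, ∫ ω, ‖D (i j ω, G j ω)‖ ^ 2 ∂P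
      ≤ 2 * d / ℓ * (L * ‖x - x₀‖) ^ 2 + 2 * d ^ 2 / ℓ * (L * β) ^ 2 := by
    intro j
    rw [hD]
    exact integral_norm_sample_sq_le hn hℓ hℓd hf hβ (hi j) (hG j) (law_i j) (law_G j) (hpair j) x₀ x
  have hDmean : ∀ j, ‖∫ ω, D (i j ω, G j ω) ∂P
      - (gradient (avg f) x - gradient (avg f) x₀)‖ ≤ d * (L * β) := by
    intro j
    rw [hD]
    exact norm_integral_sample_sub_le hn hℓ hℓd hf hβ (hi j) (hG j) (law_i j) (law_G j) (hpair j)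
      x₀ x
  have h8 : ∀ ω, direction ℓ f β x₀ x (fun j => i j ω) (fun j => G j ω) - gradient (avg f) x
      = (1 / (b : ℝ)) • ∑ j, D (i j ω, G j ω) + (fullApprox (avg f) x₀ β - gradient (avg f) x) := by
    intro ω
    rw [direction, add_sub_assoc, hD]
  simp_rw [h8]
  clear h8 hD
  set Y : Fin b → Ω → E d := fun j ω => D (i j ω, G j ω) with hYdef
  have hY : ∀ j, Measurable (Y j) := fun j => hDm.comp ((hi j).prodMk (hG j))
  have hYind : Pairwise fun j k => IndepFun (Y j) (Y k) P := fun j k hjk =>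
    (hind hjk).comp hDm hDm
  set c := fullApprox (avg f) x₀ β - gradient (avg f) x with hc
  set A := gradient (avg f) x - gradient (avg f) x₀ with hA
  have h1 := integral_norm_average_add_sq_le P Y hY _
    (fun j ω => hDb _) hYind c
  have h2 : ∑ j, ∫ ω, ‖Y j ω‖ ^ 2 ∂P
      ≤ b * (2 * d / ℓ * (L * ‖x - x₀‖) ^ 2 + 2 * d ^ 2 / ℓ * (L * β) ^ 2) := by
    refine (Finset.sum_le_sum fun j _ => hDsq j).trans ?_
    simp [mul_add]
  have h3 : ‖(1 / (b : ℝ)) • ∑ j, (∫ ω, Y j ω ∂P - A)‖ ≤ d * (L * β) :=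
    norm_average_le hb hDmean
  have h4 := (isSmoothWith_avg hn hf).norm_fullApprox_sub_gradient_sq_le hβ x₀
  -- The snapshot gradient cancels: what remains of the mean error is the bias of the structured
  -- estimator plus that of the full finite difference at `x₀`.
  have h5 : (1 / (b : ℝ)) • ∑ j, ∫ ω, Y j ω ∂P + c
      = (1 / (b : ℝ)) • ∑ j, (∫ ω, Y j ω ∂P - A)
        + (fullApprox (avg f) x₀ β - gradient (avg f) x₀) := by
    rw [← average_sub hb, hc, hA]
    abel
  -- This squared bias produces the `2d + 1/2` of the statement; the `2d/(ℓb)` beside it comes from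
  -- the second moments in `h2`.
  have h6 : ‖(1 / (b : ℝ)) • ∑ j, ∫ ω, Y j ω ∂P + c‖ ^ 2
      ≤ 2 * (d * (L * β)) ^ 2 + 2 * (d * (L * β / 2) ^ 2) := by
    rw [h5]
    refine (pow_le_pow_left₀ (norm_nonneg _) (norm_add_le _ _) 2).trans ?_
    have h7 := pow_le_pow_left₀ (norm_nonneg _) h3 2
    refine add_sq_le.trans ?_
    linarith
  have h9 := mul_le_mul_of_nonneg_left h2 (sq_nonneg (1 / (b : ℝ)))
  refine (h1.trans (add_le_add h9 h6)).trans (le_of_eq ?_)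
  field_simp
  ring

/-! ### Regularity of the search direction, and freezing of independent variables -/

theorem measurable_fullApprox {d : ℕ} {φ : E d → ℝ} (hφ : Continuous φ) (β : ℝ) :
    Measurable fun x : E d => fullApprox φ x β := by
  unfold fullApprox
  fun_prop

theorem measurable_direction {Ω : Type*} [MeasurableSpace Ω] {d n b : ℕ} (ℓ : ℕ)
    {f : Fin n → E d → ℝ} (hf : ∀ k, Continuous (f k)) (β : ℝ) {x₀ x : Ω → E d}
    (hx₀ : Measurable x₀) (hx : Measurable x) {i : Fin b → Ω → Fin n}
    (hi : ∀ j, Measurable (i j)) {G : Fin b → Ω → O d} (hG : ∀ j, Measurable (G j)) :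
    Measurable fun ω => direction ℓ f β (x₀ ω) (x ω) (fun j => i j ω) (fun j => G j ω) := by
  have havg : Continuous (avg f) := by
    unfold avg
    fun_prop
  have h1 : Measurable fun ω => ∑ j, (structApprox ℓ (f (i j ω)) (x ω) (G j ω) β
      - structApprox ℓ (f (i j ω)) (x₀ ω) (G j ω) β) :=
    Finset.measurable_sum (M := E d) _ fun j _ =>
      measurable_structApprox_sub hf β hx₀ hx (hi j) (hG j)
  have h2 : Measurable fun ω => fullApprox (avg f) (x₀ ω) β :=
    (measurable_fullApprox havg β).comp hx₀
  exact (h1.const_smul (1 / (b : ℝ))).add h2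

theorem exists_norm_direction_le {d n b ℓ : ℕ} (hb : 0 < b) (hℓ : 1 ≤ ℓ) (hℓd : ℓ ≤ d)
    {L : ℝ} (hL : 0 ≤ L) {f : Fin n → E d → ℝ} (hf : ∀ k, IsSmoothWith L (f k)) {β : ℝ}
    (hβ : 0 < β) (R : ℝ) : ∃ C, ∀ x₀ x : E d, ‖x₀‖ ≤ R → ‖x‖ ≤ R →
      ∀ (i : Fin b → Fin n) (G : Fin b → O d), ‖direction ℓ f β x₀ x i G‖ ≤ C := by
  have hcont : Continuous fun x : E d => fullApprox (avg f) x β := by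
    have : Continuous (avg f) := (differentiable_avg hf).continuous
    unfold fullApprox
    fun_prop
  obtain ⟨C₁, hC₁⟩ := (isCompact_closedBall (0 : E d) R).exists_bound_of_continuousOn
    hcont.continuousOn
  refine ⟨d * (L * (R + R) + L * β) + C₁, fun x₀ x h₀ h i G => ?_⟩
  unfold direction
  refine (norm_add_le _ _).trans (add_le_add ?_ (hC₁ x₀ (by simpa using h₀)))
  refine norm_average_le hb fun j => ?_
  refine ((hf _).norm_structApprox_sub_le hℓ hℓd hβ x₀ x _).trans ?_
  gcongr
  exact (norm_sub_le _ _).trans (add_le_add h h₀)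

theorem continuous_gradMap {d n : ℕ} (hn : 0 < n) {L : ℝ} {f : Fin n → E d → ℝ}
    (hf : ∀ k, IsSmoothWith L (f k)) {h : E d → EReal} (hh : IsConvexProximable h) {γ : ℝ}
    (hγ : 0 < γ) : Continuous (gradMap f h γ) := by
  have h1 := (isSmoothWith_avg hn hf).continuous_gradient
  have h2 := continuous_prox hh hγ
  unfold gradMap
  fun_prop

/-- The joint law of `X` and `S` is a product, so Fubini allows `X` to be frozen. This replaces
conditioning on the past. -/
theorem integral_comp_le_of_indepFun {Ω A B : Type*} [MeasurableSpace Ω] [MeasurableSpace A]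
    [MeasurableSpace B] {P : Measure Ω} [IsProbabilityMeasure P] {X : Ω → A} {S : Ω → B}
    (hX : Measurable X) (hS : Measurable S) (hind : IndepFun X S P) {Φ : A × B → ℝ}
    (hΦ : Measurable Φ) (hint : Integrable (fun ω => Φ (X ω, S ω)) P) {u : A → ℝ}
    (hu : Measurable u) (huint : Integrable (fun ω => u (X ω)) P)
    (h : ∀ a, ∫ ω, Φ (a, S ω) ∂P ≤ u a) :
    ∫ ω, Φ (X ω, S ω) ∂P ≤ ∫ ω, u (X ω) ∂P := by
  have : IsProbabilityMeasure (P.map X) := Measure.isProbabilityMeasure_map hX.aemeasurable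
  have : IsProbabilityMeasure (P.map S) := Measure.isProbabilityMeasure_map hS.aemeasurable
  have hlaw := (indepFun_iff_map_prod_eq_prod_map_map hX.aemeasurable hS.aemeasurable).1 hind
  have hint' : Integrable Φ ((P.map X).prod (P.map S)) := by
    rw [← hlaw]
    exact (integrable_map_measure hΦ.aestronglyMeasurable (hX.prodMk hS).aemeasurable).2 hint
  have huint' : Integrable u (P.map X) :=
    (integrable_map_measure hu.aestronglyMeasurable hX.aemeasurable).2 huint
  calc ∫ ω, Φ (X ω, S ω) ∂P = ∫ q, Φ q ∂((P.map X).prod (P.map S)) := by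
        rw [← hlaw, integral_map (hX.prodMk hS).aemeasurable hΦ.aestronglyMeasurable]
    _ = ∫ a, ∫ s, Φ (a, s) ∂(P.map S) ∂(P.map X) := integral_prod _ hint'
    _ ≤ ∫ a, u a ∂(P.map X) := by
        refine integral_mono hint'.integral_prod_left huint' fun a => ?_
        have h1 : Measurable fun s => Φ (a, s) := hΦ.comp measurable_prodMk_left
        change ∫ s, Φ (a, s) ∂(P.map S) ≤ u a
        rw [integral_map hS.aemeasurable h1.aestronglyMeasurable]
        exact h a
    _ = ∫ ω, u (X ω) ∂P := integral_map hX.aemeasurable hu.aestronglyMeasurable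

/-! ### Past samples, measurability and boundedness of the iterates -/

namespace IsRun

variable {Ω : Type*} {d n b ℓ m T : ℕ} {f : Fin n → E d → ℝ} {h : E d → EReal} {γ : ℝ}
  {β : ℕ → ℝ} {x₀ : E d} {i : ℕ → ℕ → Fin b → Ω → Fin n}
  {G : ℕ → ℕ → Fin b → Ω → O d} {x : ℕ → ℕ → Ω → E d}

/-- The inner step may also use the property at `(τ, 0)`, since the snapshot enters every update of
its loop. -/
theorem loop_induction {m T : ℕ} {Q : ℕ → ℕ → Prop} (h0 : Q 0 0)
    (hin : ∀ τ ≤ T, ∀ k < m, Q τ 0 → Q τ k → Q τ (k + 1))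
    (hout : ∀ τ < T, Q τ m → Q (τ + 1) 0) : ∀ τ ≤ T, ∀ k ≤ m, Q τ k := by
  have inner : ∀ τ ≤ T, Q τ 0 → ∀ k ≤ m, Q τ k := by
    intro τ hτ hQ k
    induction k with
    | zero => exact fun _ => hQ
    | succ k ih => exact fun hk => hin τ hτ k hk hQ (ih (by omega))
  intro τ
  induction τ with
  | zero => exact fun hτ => inner 0 hτ h0
  | succ τ ih => exact fun hτ => inner _ hτ (hout τ hτ (ih (by omega) m le_rfl))

/-- The samples, as a single family. -/
def sample (T m : ℕ) (i : ℕ → ℕ → Fin b → Ω → Fin n) (G : ℕ → ℕ → Fin b → Ω → O d)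
    (p : Fin (T + 1) × Fin m × Fin b) (ω : Ω) : Fin n × O d :=
  (i p.1 p.2.1 p.2.2 ω, G p.1 p.2.1 p.2.2 ω)

/-- The indices of the samples drawn before step `(τ, k)`. -/
def past (T m b τ k : ℕ) : Set (Fin (T + 1) × Fin m × Fin b) :=
  {p | (p.1 : ℕ) < τ ∨ ((p.1 : ℕ) = τ ∧ (p.2.1 : ℕ) < k)}

/-- The indices of the samples drawn at step `(τ, k)`. -/
def present (T m b τ k : ℕ) : Set (Fin (T + 1) × Fin m × Fin b) :=
  {p | (p.1 : ℕ) = τ ∧ (p.2.1 : ℕ) = k}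

/-- The `σ`-algebra generated by the samples with index in `S`. -/
abbrev sigma (T m : ℕ) (i : ℕ → ℕ → Fin b → Ω → Fin n) (G : ℕ → ℕ → Fin b → Ω → O d)
    (S : Set (Fin (T + 1) × Fin m × Fin b)) : MeasurableSpace Ω :=
  ⨆ p ∈ S, MeasurableSpace.comap (sample T m i G p) inferInstance

theorem sigma_mono {S S' : Set (Fin (T + 1) × Fin m × Fin b)} (hS : S ⊆ S') :
    sigma T m i G S ≤ sigma T m i G S' :=
  biSup_mono fun _ hp => hS hp

theorem measurable_sample_sigma {S : Set (Fin (T + 1) × Fin m × Fin b)}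
    {p : Fin (T + 1) × Fin m × Fin b} (hp : p ∈ S) :
    Measurable[sigma T m i G S] (sample T m i G p) :=
  (comap_measurable _).mono
    (le_iSup₂_of_le (f := fun q (_ : q ∈ S) => MeasurableSpace.comap (sample T m i G q)
      inferInstance) p hp le_rfl) le_rfl

theorem measurable_index_sigma {S : Set (Fin (T + 1) × Fin m × Fin b)} {τ k : ℕ} (hτ : τ ≤ T)
    (hk : k < m) (j : Fin b) (hp : present T m b τ k ⊆ S) :
    Measurable[sigma T m i G S] (i τ k j) ∧ Measurable[sigma T m i G S] (G τ k j) := by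
  have h1 := measurable_sample_sigma (i := i) (G := G)
    (hp (show ((⟨τ, by omega⟩, ⟨k, hk⟩, j) : Fin (T + 1) × Fin m × Fin b) ∈ _ from ⟨rfl, rfl⟩))
  exact ⟨measurable_fst.comp h1, measurable_snd.comp h1⟩

variable [MeasurableSpace Ω] {P : Measure Ω}

theorem measurable_sample (hrun : IsRun P ℓ m T f h γ β x₀ i G x)
    (p : Fin (T + 1) × Fin m × Fin b) : Measurable (sample T m i G p) :=
  (hrun.measurable_i p.1 (by omega) p.2.1 p.2.1.2 p.2.2).prodMk
    (hrun.measurable_G p.1 (by omega) p.2.1 p.2.1.2 p.2.2)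

theorem sigma_le (hrun : IsRun P ℓ m T f h γ β x₀ i G x)
    (S : Set (Fin (T + 1) × Fin m × Fin b)) : sigma T m i G S ≤ ‹MeasurableSpace Ω› :=
  iSup₂_le fun p _ => (hrun.measurable_sample p).comap_le

theorem indep_sigma (hrun : IsRun P ℓ m T f h γ β x₀ i G x)
    {S S' : Set (Fin (T + 1) × Fin m × Fin b)} (hS : Disjoint S S') :
    Indep (sigma T m i G S) (sigma T m i G S') P :=
  indep_iSup_of_disjoint (fun p => (hrun.measurable_sample p).comap_le) hrun.indep hS

/-- The iterates are determined by the past samples. -/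
theorem measurable_iterate_sigma (hrun : IsRun P ℓ m T f h γ β x₀ i G x) {L : ℝ}
    (hf : ∀ k, IsSmoothWith L (f k)) (hh : IsConvexProximable h) (hγ : 0 < γ) :
    ∀ τ ≤ T, ∀ k ≤ m, Measurable[sigma T m i G (past T m b τ k)] (x τ k) := by
  refine loop_induction ?_ ?_ ?_
  · rw [show x 0 0 = fun _ => x₀ from funext hrun.init]
    exact measurable_const
  · intro τ hτ k hk h0 hk'
    rw [show x τ (k + 1) = _ from funext (hrun.inner τ hτ k hk)]
    have m0 : Measurable[sigma T m i G (past T m b τ (k + 1))] (x τ 0) :=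
      h0.mono (sigma_mono fun p hp => by simp only [past, Set.mem_ofPred_eq] at hp ⊢; omega) le_rfl
    have mk : Measurable[sigma T m i G (past T m b τ (k + 1))] (x τ k) :=
      hk'.mono (sigma_mono fun p hp => by simp only [past, Set.mem_ofPred_eq] at hp ⊢; omega) le_rfl
    have ms := fun j => measurable_index_sigma (i := i) (G := G) hτ hk j
      (S := past T m b τ (k + 1)) (fun p hp => by
        simp only [past, present, Set.mem_ofPred_eq] at hp ⊢; omega)
    have md := @measurable_direction Ω (sigma T m i G (past T m b τ (k + 1))) d n b ℓ f
      (fun k => (hf k).1.continuous) (β τ) _ _ m0 mk _ (fun j => (ms j).1) _ (fun j => (ms j).2)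
    have mp := (continuous_prox hh hγ).measurable
    exact mp.comp (mk.sub (md.const_smul γ))
  · intro τ hτ hm
    rw [show x (τ + 1) 0 = x τ m from funext (hrun.outer τ hτ.le)]
    exact hm.mono (sigma_mono fun p hp => by
      simp only [past, Set.mem_ofPred_eq] at hp ⊢; omega) le_rfl

theorem measurable_iterate (hrun : IsRun P ℓ m T f h γ β x₀ i G x) {L : ℝ}
    (hf : ∀ k, IsSmoothWith L (f k)) (hh : IsConvexProximable h) (hγ : 0 < γ)
    {τ k : ℕ} (hτ : τ ≤ T) (hk : k ≤ m) : Measurable (x τ k) :=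
  (hrun.measurable_iterate_sigma hf hh hγ τ hτ k hk).mono (hrun.sigma_le _) le_rfl

/-- The start is deterministic, the direction is bounded uniformly over all samples when the points
stay in a ball, and the continuous `prox` is bounded on balls. All integrability along the run
follows from this. -/
theorem exists_norm_iterate_le (hrun : IsRun P ℓ m T f h γ β x₀ i G x) (hb : 0 < b)
    (hℓ : 1 ≤ ℓ) (hℓd : ℓ ≤ d) {L : ℝ} (hL : 0 ≤ L)
    (hf : ∀ k, IsSmoothWith L (f k)) (hh : IsConvexProximable h) (hγ : 0 < γ)
    (hβ : ∀ τ, 0 < β τ) : ∀ τ ≤ T, ∀ k ≤ m, ∃ C, ∀ ω, ‖x τ k ω‖ ≤ C := by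
  refine loop_induction ?_ ?_ ?_
  · exact ⟨‖x₀‖, fun ω => by rw [hrun.init ω]⟩
  · rintro τ hτ k hk ⟨C₀, h₀⟩ ⟨C₁, h₁⟩
    obtain ⟨C, hC⟩ := exists_norm_direction_le (b := b) hb hℓ hℓd hL hf (hβ τ) (max C₀ C₁)
    obtain ⟨D, hD⟩ := (isCompact_closedBall (0 : E d) (C₁ + γ * C)).exists_bound_of_continuousOn
      (continuous_prox hh hγ).continuousOn
    refine ⟨D, fun ω => ?_⟩
    rw [hrun.inner τ hτ k hk ω]
    refine hD _ ?_
    rw [mem_closedBall_zero_iff]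
    refine (norm_sub_le _ _).trans (add_le_add (h₁ ω) ?_)
    rw [norm_smul, Real.norm_of_nonneg hγ.le]
    gcongr
    exact hC _ _ ((h₀ ω).trans (le_max_left _ _)) ((h₁ ω).trans (le_max_right _ _)) _ _
  · rintro τ hτ ⟨C, hC⟩
    exact ⟨C, fun ω => by rw [hrun.outer τ hτ.le ω]; exact hC ω⟩

end IsRun

theorem integrable_norm_sq_of_bound {Ω : Type*} [MeasurableSpace Ω] {P : Measure Ω}
    [IsFiniteMeasure P] {d : ℕ} {Y : Ω → E d} (hY : Measurable Y) {C : ℝ}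
    (hC : ∀ ω, ‖Y ω‖ ≤ C) : Integrable (fun ω => ‖Y ω‖ ^ 2) P := by
  refine Integrable.of_bound (hY.norm.pow_const 2).aestronglyMeasurable (C ^ 2)
    (ae_of_all _ fun ω => ?_)
  rw [Real.norm_of_nonneg (by positivity)]
  exact pow_le_pow_left₀ (norm_nonneg _) (hC ω) 2

/-- Telescoping and Cauchy–Schwarz bound the `k`-th term by `k` times the full sum of squared steps,
and `0 + ⋯ + (m - 1) ≤ m²/2`. -/
theorem sum_norm_sub_sq_le {V : Type*} [NormedAddCommGroup V] (y : ℕ → V) (m : ℕ) :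
    ∑ k ∈ Finset.range m, ‖y k - y 0‖ ^ 2
      ≤ (m : ℝ) ^ 2 / 2 * ∑ k ∈ Finset.range m, ‖y (k + 1) - y k‖ ^ 2 := by
  have h1 : ∀ k ∈ Finset.range m, ‖y k - y 0‖ ^ 2
      ≤ (k : ℝ) * ∑ j ∈ Finset.range m, ‖y (j + 1) - y j‖ ^ 2 := by
    intro k hk
    have hk' : k ≤ m := (Finset.mem_range.1 hk).le
    rw [← Finset.sum_range_sub]
    calc ‖∑ j ∈ Finset.range k, (y (j + 1) - y j)‖ ^ 2
        ≤ (∑ j ∈ Finset.range k, ‖y (j + 1) - y j‖) ^ 2 := by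
          gcongr
          exact norm_sum_le _ _
      _ ≤ (k : ℝ) * ∑ j ∈ Finset.range k, ‖y (j + 1) - y j‖ ^ 2 := by
          have := sq_sum_le_card_mul_sum_sq (s := Finset.range k)
            (f := fun j => ‖y (j + 1) - y j‖)
          rwa [Finset.card_range] at this
      _ ≤ _ := by
          gcongr
  refine (Finset.sum_le_sum h1).trans ?_
  rw [← Finset.sum_mul]
  gcongr
  have h2 := Finset.sum_range_id_mul_two m
  have h3 : (∑ k ∈ Finset.range m, (k : ℝ)) * 2 ≤ m * m := by
    rw [← Nat.cast_sum]
    exact_mod_cast h2.trans_le (Nat.mul_le_mul_left m (Nat.sub_le m 1))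
  linarith

/-! ### Descent along a run and the error in mean -/

namespace IsRun

variable {Ω : Type*} [MeasurableSpace Ω] {P : Measure Ω} {d n b ℓ m T : ℕ}
  {f : Fin n → E d → ℝ} {h : E d → EReal} {γ : ℝ} {β : ℕ → ℝ} {x₀ : E d}
  {i : ℕ → ℕ → Fin b → Ω → Fin n} {G : ℕ → ℕ → Fin b → Ω → O d} {x : ℕ → ℕ → Ω → E d}
  {L : ℝ}

/-- The error of the search direction at step `(τ, k)`. -/
def directionError (ℓ : ℕ) (f : Fin n → E d → ℝ) (β : ℕ → ℝ)
    (i : ℕ → ℕ → Fin b → Ω → Fin n) (G : ℕ → ℕ → Fin b → Ω → O d) (x : ℕ → ℕ → Ω → E d)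
    (τ k : ℕ) (ω : Ω) : E d :=
  direction ℓ f (β τ) (x τ 0 ω) (x τ k ω) (fun j => i τ k j ω) (fun j => G τ k j ω)
    - gradient (avg f) (x τ k ω)

/-- The two iterates are measurable with respect to the past samples, whose indices are disjoint
from those drawn at step `(τ, k)`. -/
theorem indepFun_iterates_samples (hrun : IsRun P ℓ m T f h γ β x₀ i G x)
    (hf : ∀ k, IsSmoothWith L (f k)) (hh : IsConvexProximable h) (hγ : 0 < γ)
    {τ k : ℕ} (hτ : τ ≤ T) (hk : k < m) :
    IndepFun (fun ω => (x τ 0 ω, x τ k ω)) (fun ω j => (i τ k j ω, G τ k j ω)) P := by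
  have hdisj : Disjoint (past T m b τ k) (present T m b τ k) := by
    rw [Set.disjoint_left]
    intro p hp hp'
    simp only [past, present, Set.mem_ofPred_eq] at hp hp'
    omega
  have hind := hrun.indep_sigma hdisj
  have m0 : Measurable[sigma T m i G (past T m b τ k)] (x τ 0) :=
    (hrun.measurable_iterate_sigma hf hh hγ τ hτ 0 (Nat.zero_le m)).mono
      (sigma_mono fun p hp => by simp only [past, Set.mem_ofPred_eq] at hp ⊢; omega) le_rfl
  have mk := hrun.measurable_iterate_sigma hf hh hγ τ hτ k hk.le
  have ms := fun j => measurable_index_sigma (i := i) (G := G) hτ hk j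
    (S := present T m b τ k) subset_rfl
  have mX : Measurable[sigma T m i G (past T m b τ k)] fun ω => (x τ 0 ω, x τ k ω) := m0.prodMk mk
  have mS : Measurable[sigma T m i G (present T m b τ k)] fun ω j => (i τ k j ω, G τ k j ω) :=
    @measurable_pi_lambda _ _ _ (sigma T m i G (present T m b τ k)) _ _
      fun j => (ms j).1.prodMk (ms j).2
  rw [IndepFun_iff_Indep]
  exact indep_of_indep_of_le_left (indep_of_indep_of_le_right hind mS.comap_le) mX.comap_le

theorem apply_iterate_ne_top (hrun : IsRun P ℓ m T f h γ β x₀ i G x)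
    (hh : IsConvexProximable h) (hγ : 0 < γ) (hx₀ : h x₀ ≠ ⊤) (ω : Ω) :
    ∀ τ ≤ T, ∀ k ≤ m, h (x τ k ω) ≠ ⊤ := by
  refine loop_induction ?_ ?_ ?_
  · rwa [hrun.init ω]
  · intro τ hτ k hk _ _
    rw [hrun.inner τ hτ k hk ω]
    exact prox_ne_top hh hγ _
  · intro τ hτ hm
    rwa [hrun.outer τ hτ.le ω]

/-- Telescoped descent along one realization. -/
theorem sum_norm_gradMap_sq_le (hrun : IsRun P ℓ m T f h γ β x₀ i G x) (hn : 0 < n)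
    (hL : 0 ≤ L) (hf : ∀ k, IsSmoothWith L (f k))
    (hh : IsConvexProximable h) (hγ : 0 < γ) (hx₀ : h x₀ ≠ ⊤) {F : ℝ}
    (hF : ∀ y, h y ≠ ⊤ → F ≤ avg f y + (h y).toReal) (ω : Ω) :
    (1 / 2 - L * γ) * γ * ∑ τ ∈ Finset.range (T + 1), ∑ k ∈ Finset.range m,
        ‖gradMap f h γ (x τ k ω)‖ ^ 2
      ≤ avg f x₀ + (h x₀).toReal - F
        + ∑ τ ∈ Finset.range (T + 1), ∑ k ∈ Finset.range m,
          (γ / 2 * ‖directionError ℓ f β i G x τ k ω‖ ^ 2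
            - (1 / (2 * γ) - L / 2) * ‖x τ (k + 1) ω - x τ k ω‖ ^ 2) := by
  set Ψ : ℕ → ℕ → ℝ := fun τ k => avg f (x τ k ω) + (h (x τ k ω)).toReal with hΨ
  have hfin := hrun.apply_iterate_ne_top hh hγ hx₀ ω
  have hstep : ∀ τ ∈ Finset.range (T + 1), ∀ k ∈ Finset.range m,
      (1 / 2 - L * γ) * γ * ‖gradMap f h γ (x τ k ω)‖ ^ 2
        ≤ -(Ψ τ (k + 1) - Ψ τ k) + (γ / 2 * ‖directionError ℓ f β i G x τ k ω‖ ^ 2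
            - (1 / (2 * γ) - L / 2) * ‖x τ (k + 1) ω - x τ k ω‖ ^ 2) := by
    intro τ hτ k hk
    have hτ' : τ ≤ T := Nat.lt_succ_iff.1 (Finset.mem_range.1 hτ)
    have hk' := Finset.mem_range.1 hk
    have := prox_step_le hL hn hf hh hγ (x τ k ω) (direction ℓ f (β τ) (x τ 0 ω) (x τ k ω)
      (fun j => i τ k j ω) (fun j => G τ k j ω)) (hfin τ hτ' k hk'.le)
    rw [← hrun.inner τ hτ' k hk' ω] at this
    simp only [hΨ, directionError]
    linarith
  -- The last iterate of one inner loop is the next snapshot, so the telescoped inner sums join up.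
  have hloop : ∀ S ≤ T, ∑ τ ∈ Finset.range (S + 1), (Ψ τ m - Ψ τ 0) = Ψ S m - Ψ 0 0 := by
    intro S
    induction S with
    | zero => simp
    | succ S ih =>
      intro hS
      rw [Finset.sum_range_succ, ih (by omega)]
      have : Ψ (S + 1) 0 = Ψ S m := by simp only [hΨ, hrun.outer S (by omega) ω]
      rw [this]
      ring
  have hlast : F ≤ Ψ T m := hF _ (hfin T le_rfl m le_rfl)
  have hinit : Ψ 0 0 = avg f x₀ + (h x₀).toReal := by simp only [hΨ, hrun.init ω]
  rw [Finset.mul_sum]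
  simp_rw [Finset.mul_sum]
  refine (Finset.sum_le_sum fun τ hτ => Finset.sum_le_sum (hstep τ hτ)).trans ?_
  simp_rw [Finset.sum_add_distrib, Finset.sum_neg_distrib, Finset.sum_range_sub]
  rw [hloop T le_rfl]
  linarith

variable [IsProbabilityMeasure P]

theorem integrable_norm_gradMap_sq (hrun : IsRun P ℓ m T f h γ β x₀ i G x) (hn : 0 < n)
    (hb : 0 < b) (hℓ : 1 ≤ ℓ) (hℓd : ℓ ≤ d) (hL : 0 ≤ L) (hf : ∀ k, IsSmoothWith L (f k))
    (hh : IsConvexProximable h) (hγ : 0 < γ) (hβ : ∀ τ, 0 < β τ) {τ k : ℕ} (hτ : τ ≤ T)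
    (hk : k ≤ m) : Integrable (fun ω => ‖gradMap f h γ (x τ k ω)‖ ^ 2) P := by
  obtain ⟨C, hC⟩ := hrun.exists_norm_iterate_le hb hℓ hℓd hL hf hh hγ hβ τ hτ k hk
  have hcont := continuous_gradMap hn hf hh hγ
  obtain ⟨D, hD⟩ := (isCompact_closedBall (0 : E d) C).exists_bound_of_continuousOn
    hcont.continuousOn
  exact integrable_norm_sq_of_bound
    (hcont.measurable.comp (hrun.measurable_iterate hf hh hγ hτ hk))
    (fun ω => hD _ (by simpa using hC ω))

theorem integrable_norm_iterate_sub_sq (hrun : IsRun P ℓ m T f h γ β x₀ i G x)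
    (hb : 0 < b) (hℓ : 1 ≤ ℓ) (hℓd : ℓ ≤ d) (hL : 0 ≤ L) (hf : ∀ k, IsSmoothWith L (f k))
    (hh : IsConvexProximable h) (hγ : 0 < γ) (hβ : ∀ τ, 0 < β τ) {τ k k' : ℕ} (hτ : τ ≤ T)
    (hk : k ≤ m) (hk' : k' ≤ m) : Integrable (fun ω => ‖x τ k ω - x τ k' ω‖ ^ 2) P := by
  obtain ⟨C, hC⟩ := hrun.exists_norm_iterate_le hb hℓ hℓd hL hf hh hγ hβ τ hτ k hk
  obtain ⟨C', hC'⟩ := hrun.exists_norm_iterate_le hb hℓ hℓd hL hf hh hγ hβ τ hτ k' hk'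
  have hm1 := hrun.measurable_iterate hf hh hγ hτ hk
  have hm2 := hrun.measurable_iterate hf hh hγ hτ hk'
  exact integrable_norm_sq_of_bound (hm1.sub hm2)
    (fun ω => (norm_sub_le _ _).trans (add_le_add (hC ω) (hC' ω)))

theorem integrable_norm_directionError_sq (hrun : IsRun P ℓ m T f h γ β x₀ i G x) (hn : 0 < n)
    (hb : 0 < b) (hℓ : 1 ≤ ℓ) (hℓd : ℓ ≤ d) (hL : 0 ≤ L) (hf : ∀ k, IsSmoothWith L (f k))
    (hh : IsConvexProximable h) (hγ : 0 < γ) (hβ : ∀ τ, 0 < β τ) {τ k : ℕ} (hτ : τ ≤ T)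
    (hk : k < m) : Integrable (fun ω => ‖directionError ℓ f β i G x τ k ω‖ ^ 2) P := by
  obtain ⟨C₀, h₀⟩ := hrun.exists_norm_iterate_le hb hℓ hℓd hL hf hh hγ hβ τ hτ 0 (Nat.zero_le _)
  obtain ⟨C₁, h₁⟩ := hrun.exists_norm_iterate_le hb hℓ hℓd hL hf hh hγ hβ τ hτ k hk.le
  obtain ⟨C, hC⟩ := exists_norm_direction_le (b := b) hb hℓ hℓd hL hf (hβ τ) (max C₀ C₁)
  have hcont := (isSmoothWith_avg hn hf).continuous_gradient
  obtain ⟨D, hD⟩ := (isCompact_closedBall (0 : E d) C₁).exists_bound_of_continuousOn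
    hcont.continuousOn
  have hm0 := hrun.measurable_iterate hf hh hγ hτ (Nat.zero_le m)
  have hm1 := hrun.measurable_iterate hf hh hγ hτ hk.le
  have hmd := measurable_direction ℓ (fun k => (hf k).1.continuous) (β τ) hm0 hm1
    (hrun.measurable_i τ hτ k hk) (hrun.measurable_G τ hτ k hk)
  refine integrable_norm_sq_of_bound (C := C + D) (hmd.sub (hcont.measurable.comp hm1)) fun ω => ?_
  exact (norm_sub_le _ _).trans (add_le_add
    (hC _ _ ((h₀ ω).trans (le_max_left _ _)) ((h₁ ω).trans (le_max_right _ _)) _ _)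
    (hD _ (by simpa using h₁ ω)))

theorem integral_norm_directionError_sq_le (hrun : IsRun P ℓ m T f h γ β x₀ i G x) (hn : 0 < n)
    (hb : 0 < b) (hℓ : 1 ≤ ℓ) (hℓd : ℓ ≤ d) (hL : 0 ≤ L) (hf : ∀ k, IsSmoothWith L (f k))
    (hh : IsConvexProximable h) (hγ : 0 < γ) (hβ : ∀ τ, 0 < β τ) {τ k : ℕ} (hτ : τ ≤ T)
    (hk : k < m) :
    ∫ ω, ‖directionError ℓ f β i G x τ k ω‖ ^ 2 ∂P
      ≤ 2 * d / (ℓ * b) * L ^ 2 * ∫ ω, ‖x τ k ω - x τ 0 ω‖ ^ 2 ∂P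
        + (2 * d / (ℓ * b) + 2 * d + 1 / 2) * (d * (L * β τ) ^ 2) := by
  have hm0 := hrun.measurable_iterate hf hh hγ hτ (Nat.zero_le m)
  have hm1 := hrun.measurable_iterate hf hh hγ hτ hk.le
  have hcont := (isSmoothWith_avg hn hf).continuous_gradient
  have hsub := hrun.integrable_norm_iterate_sub_sq hb hℓ hℓd hL hf hh hγ hβ hτ hk.le (Nat.zero_le m)
  have hsamples : Measurable fun ω j => (i τ k j ω, G τ k j ω) := measurable_pi_lambda _ fun j =>
    (hrun.measurable_i τ hτ k hk j).prodMk (hrun.measurable_G τ hτ k hk j)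
  have hpair : Pairwise fun j j' => IndepFun (fun ω => (i τ k j ω, G τ k j ω))
      (fun ω => (i τ k j' ω, G τ k j' ω)) P := by
    intro j j' hjj'
    exact hrun.indep.indepFun (i := (⟨τ, by omega⟩, ⟨k, hk⟩, j)) (j := (⟨τ, by omega⟩, ⟨k, hk⟩, j'))
      (by simpa using hjj')
  -- The squared error as a function of the pair (snapshot, current iterate) and of the fresh
  -- samples, in the form required for freezing the former.
  obtain ⟨Φ, hΦ⟩ : ∃ Φ : (E d × E d) × (Fin b → Fin n × O d) → ℝ, Φ = fun q =>
    ‖direction ℓ f (β τ) q.1.1 q.1.2 (fun j => (q.2 j).1) (fun j => (q.2 j).2)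
      - gradient (avg f) q.1.2‖ ^ 2 := ⟨_, rfl⟩
  have hΦm : Measurable Φ := by
    rw [hΦ]
    have hs : ∀ j, Measurable fun q : (E d × E d) × (Fin b → Fin n × O d) => q.2 j :=
      fun j => (measurable_pi_apply j).comp measurable_snd
    have h1 : Measurable fun q : (E d × E d) × (Fin b → Fin n × O d) => q.1.1 :=
      measurable_fst.comp measurable_fst
    have h2 : Measurable fun q : (E d × E d) × (Fin b → Fin n × O d) => q.1.2 :=
      measurable_snd.comp measurable_fst
    have hmd := measurable_direction ℓ (fun k => (hf k).1.continuous) (β τ) h1 h2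
      (i := fun j q => (q.2 j).1) (fun j => measurable_fst.comp (hs j))
      (G := fun j q => (q.2 j).2) (fun j => measurable_snd.comp (hs j))
    exact ((hmd.sub (hcont.measurable.comp h2)).norm).pow_const 2
  have hΦint : Integrable (fun ω => Φ ((x τ 0 ω, x τ k ω), fun j => (i τ k j ω, G τ k j ω))) P := by
    rw [hΦ]
    exact hrun.integrable_norm_directionError_sq hn hb hℓ hℓd hL hf hh hγ hβ hτ hk
  have hΦle : ∀ a : E d × E d, ∫ ω, Φ (a, fun j => (i τ k j ω, G τ k j ω)) ∂P
      ≤ 2 * d / (ℓ * b) * L ^ 2 * ‖a.2 - a.1‖ ^ 2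
        + (2 * d / (ℓ * b) + 2 * d + 1 / 2) * (d * (L * β τ) ^ 2) := by
    intro a
    rw [hΦ]
    refine (integral_norm_direction_sub_gradient_sq_le hn hb hℓ hℓd hf (hβ τ)
      (hrun.measurable_i τ hτ k hk) (hrun.measurable_G τ hτ k hk) (hrun.law_i τ hτ k hk)
      (hrun.law_G τ hτ k hk) (hrun.indep_pair τ hτ k hk) hpair a.1 a.2).trans (le_of_eq ?_)
    ring
  have hmain := integral_comp_le_of_indepFun (hm0.prodMk hm1) hsamples
    (hrun.indepFun_iterates_samples hf hh hγ hτ hk) hΦm hΦint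
    (u := fun a : E d × E d => 2 * d / (ℓ * b) * L ^ 2 * ‖a.2 - a.1‖ ^ 2
        + (2 * d / (ℓ * b) + 2 * d + 1 / 2) * (d * (L * β τ) ^ 2))
    (by fun_prop) ((hsub.const_mul _).add (integrable_const _)) hΦle
  have hl : ∀ ω, ‖directionError ℓ f β i G x τ k ω‖ ^ 2
      = Φ ((x τ 0 ω, x τ k ω), fun j => (i τ k j ω, G τ k j ω)) := by
    intro ω
    rw [hΦ, directionError]
  simp_rw [hl]
  refine hmain.trans (le_of_eq ?_)
  rw [integral_add (hsub.const_mul _) (integrable_const _), integral_const_mul]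
  simp

end IsRun

/-! ### Step size, absorption of the variance and conclusion -/

/-- After multiplication by `2γ` the claim is `γ² d L² m² / (ℓb) ≤ 1 - γL`. The hypotheses bound the
left side by `1/32`, using only `e - 1 ≥ 1`, and the right side below by `3/4`. -/
theorem step_size_le {d b ℓ m : ℕ} (hb : 0 < b) (hℓ : 1 ≤ ℓ) (hℓd : ℓ ≤ d) (hm : 1 < m) {L : ℝ}
    (hL : 0 < L) {γ : ℝ} (hγ : 0 < γ) (hγ₁ : γ < 1 / (4 * L))
    (hγ₂ : γ < √((ℓ : ℝ) * b) / (√(32 * (Real.exp 1 - 1) * d) * L * m)) :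
    γ / 2 * (2 * d / (ℓ * b) * L ^ 2) * ((m : ℝ) ^ 2 / 2) ≤ 1 / (2 * γ) - L / 2 := by
  have hb' : (0 : ℝ) < b := by exact_mod_cast hb
  have hℓ' : (0 : ℝ) < ℓ := by exact_mod_cast hℓ
  have hd' : (0 : ℝ) < d := by exact_mod_cast hℓ.trans hℓd
  have hm' : (0 : ℝ) < m := by exact_mod_cast (zero_lt_one.trans hm)
  have he : (1 : ℝ) ≤ Real.exp 1 - 1 := by
    have := Real.add_one_le_exp (1 : ℝ)
    linarith
  have hK : 0 < 32 * (Real.exp 1 - 1) * d := by positivity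
  have hD : 0 < √(32 * (Real.exp 1 - 1) * d) * L * m := by positivity
  rw [lt_div_iff₀ hD] at hγ₂
  have h1 := pow_le_pow_left₀ (by positivity) hγ₂.le 2
  rw [Real.sq_sqrt (by positivity), mul_pow, mul_pow, mul_pow, Real.sq_sqrt hK.le] at h1
  have h2 : γ ^ 2 * (32 * 1 * d * L ^ 2 * m ^ 2) ≤ ℓ * b := by
    refine le_trans ?_ h1
    gcongr
  have h3 : γ * L ≤ 1 / 4 := by
    rw [lt_div_iff₀ (by positivity)] at hγ₁
    linarith
  have e1 : γ / 2 * (2 * d / (ℓ * b) * L ^ 2) * ((m : ℝ) ^ 2 / 2)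
      = γ ^ 2 * (d * L ^ 2 * m ^ 2) / (ℓ * b) / (2 * γ) := by
    field_simp
  have e2 : 1 / (2 * γ) - L / 2 = (1 - γ * L) / (2 * γ) := by
    field_simp
  rw [e1, e2]
  refine div_le_div_of_nonneg_right ?_ (by positivity)
  rw [div_le_iff₀ (by positivity)]
  nlinarith [mul_pos hℓ' hb']

theorem avg_add_toReal_le {d n : ℕ} {f : Fin n → E d → ℝ} {h : E d → EReal}
    (hh : IsConvexProximable h) {xmin : E d} (hmin : ∀ y, objective f h xmin ≤ objective f h y) :
    h xmin ≠ ⊤ ∧ ∀ y, h y ≠ ⊤ →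
      avg f xmin + (h xmin).toReal ≤ avg f y + (h y).toReal := by
  have hfin : h xmin ≠ ⊤ := by
    obtain ⟨z, hz⟩ := hh.proper
    intro htop
    have h1 := hmin z
    rw [objective, objective, htop, EReal.coe_add_top, top_le_iff] at h1
    exact EReal.add_ne_top (EReal.coe_ne_top _) hz h1
  refine ⟨hfin, fun y hy => ?_⟩
  have h1 := hmin y
  rw [objective, objective, ← EReal.coe_toReal hfin (hh.ne_bot _),
    ← EReal.coe_toReal hy (hh.ne_bot _)] at h1
  exact_mod_cast h1

namespace IsRun

variable {Ω : Type*} [MeasurableSpace Ω] {P : Measure Ω} [IsProbabilityMeasure P]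
  {d n b ℓ m T : ℕ} {f : Fin n → E d → ℝ} {h : E d → EReal} {γ : ℝ} {β : ℕ → ℝ} {x₀ : E d}
  {i : ℕ → ℕ → Fin b → Ω → Fin n} {G : ℕ → ℕ → Fin b → Ω → O d} {x : ℕ → ℕ → Ω → E d}
  {L : ℝ}

/-- Over one outer iteration, the variance of the search directions is absorbed by the lengths of
the steps. -/
theorem sum_integral_error_le (hrun : IsRun P ℓ m T f h γ β x₀ i G x) (hn : 0 < n)
    (hb : 0 < b) (hℓ : 1 ≤ ℓ) (hℓd : ℓ ≤ d) (hL : 0 ≤ L) (hf : ∀ k, IsSmoothWith L (f k))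
    (hh : IsConvexProximable h) (hγ : 0 < γ) (hβ : ∀ τ, 0 < β τ)
    (hstep : γ / 2 * (2 * d / (ℓ * b) * L ^ 2) * ((m : ℝ) ^ 2 / 2) ≤ 1 / (2 * γ) - L / 2)
    {τ : ℕ} (hτ : τ ≤ T) :
    ∑ k ∈ Finset.range m, (γ / 2 * ∫ ω, ‖directionError ℓ f β i G x τ k ω‖ ^ 2 ∂P
        - (1 / (2 * γ) - L / 2) * ∫ ω, ‖x τ (k + 1) ω - x τ k ω‖ ^ 2 ∂P)
      ≤ m * (γ / 2 * ((2 * d / (ℓ * b) + 2 * d + 1 / 2) * (d * (L * β τ) ^ 2))) := by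
  set κ : ℝ := 2 * d / (ℓ * b) * L ^ 2 with hκ
  set ε : ℝ := (2 * d / (ℓ * b) + 2 * d + 1 / 2) * (d * (L * β τ) ^ 2) with hε
  have hκ0 : 0 ≤ κ := by positivity
  have i1 : ∀ k ∈ Finset.range m, Integrable (fun ω => ‖x τ k ω - x τ 0 ω‖ ^ 2) P := fun k hk =>
    hrun.integrable_norm_iterate_sub_sq hb hℓ hℓd hL hf hh hγ hβ hτ (Finset.mem_range.1 hk).le
      (Nat.zero_le m)
  have i2 : ∀ k ∈ Finset.range m, Integrable (fun ω => ‖x τ (k + 1) ω - x τ k ω‖ ^ 2) P :=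
    fun k hk => hrun.integrable_norm_iterate_sub_sq hb hℓ hℓd hL hf hh hγ hβ hτ
      (Finset.mem_range.1 hk) (Finset.mem_range.1 hk).le
  have h1 : ∑ k ∈ Finset.range m, ∫ ω, ‖x τ k ω - x τ 0 ω‖ ^ 2 ∂P
      ≤ (m : ℝ) ^ 2 / 2 * ∑ k ∈ Finset.range m, ∫ ω, ‖x τ (k + 1) ω - x τ k ω‖ ^ 2 ∂P := by
    rw [← integral_finsetSum _ i1, ← integral_finsetSum _ i2, ← integral_const_mul]
    exact integral_mono (integrable_finsetSum _ i1) ((integrable_finsetSum _ i2).const_mul _)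
      fun ω => sum_norm_sub_sq_le (fun k => x τ k ω) m
  have h2 : ∑ k ∈ Finset.range m, ∫ ω, ‖directionError ℓ f β i G x τ k ω‖ ^ 2 ∂P
      ≤ κ * ∑ k ∈ Finset.range m, ∫ ω, ‖x τ k ω - x τ 0 ω‖ ^ 2 ∂P + m * ε := by
    refine (Finset.sum_le_sum fun k hk => hrun.integral_norm_directionError_sq_le hn hb hℓ hℓd hL
      hf hh hγ hβ hτ (Finset.mem_range.1 hk)).trans (le_of_eq ?_)
    rw [Finset.sum_add_distrib, ← Finset.mul_sum, Finset.sum_const, Finset.card_range, nsmul_eq_mul]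
  rw [Finset.sum_sub_distrib, ← Finset.mul_sum, ← Finset.mul_sum]
  have h3 : 0 ≤ ∑ k ∈ Finset.range m, ∫ ω, ‖x τ (k + 1) ω - x τ k ω‖ ^ 2 ∂P :=
    Finset.sum_nonneg fun k _ => integral_nonneg fun ω => by positivity
  have h4 := mul_le_mul_of_nonneg_left h1 (mul_nonneg (half_pos hγ).le hκ0)
  have h5 := mul_le_mul_of_nonneg_left h2 (half_pos hγ).le
  -- Chaining `h5` and `h4`, the part of the error proportional to the squared steps has the
  -- coefficient on the left of `hstep`, so the negative terms absorb it.
  have h6 := mul_le_mul_of_nonneg_right hstep h3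
  linarith

theorem sum_integral_norm_gradMap_sq_le (hrun : IsRun P ℓ m T f h γ β x₀ i G x) (hn : 0 < n)
    (hb : 0 < b) (hℓ : 1 ≤ ℓ) (hℓd : ℓ ≤ d) (hL : 0 ≤ L) (hf : ∀ k, IsSmoothWith L (f k))
    (hh : IsConvexProximable h) (hγ : 0 < γ) (hβ : ∀ τ, 0 < β τ)
    (hstep : γ / 2 * (2 * d / (ℓ * b) * L ^ 2) * ((m : ℝ) ^ 2 / 2) ≤ 1 / (2 * γ) - L / 2)
    (hx₀ : h x₀ ≠ ⊤) {F : ℝ} (hF : ∀ y, h y ≠ ⊤ → F ≤ avg f y + (h y).toReal) :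
    (1 / 2 - L * γ) * γ * ∑ τ ∈ Finset.range (T + 1), ∑ k ∈ Finset.range m,
        ∫ ω, ‖gradMap f h γ (x τ k ω)‖ ^ 2 ∂P
      ≤ avg f x₀ + (h x₀).toReal - F
        + m * γ / 2 * ((2 * d / (ℓ * b) + 2 * d + 1 / 2) * (d * L ^ 2))
          * ∑ τ ∈ Finset.range (T + 1), β τ ^ 2 := by
  have hτT : ∀ {τ}, τ ∈ Finset.range (T + 1) → τ ≤ T := fun hτ =>
    Nat.lt_succ_iff.1 (Finset.mem_range.1 hτ)
  have ig : ∀ τ ∈ Finset.range (T + 1), ∀ k ∈ Finset.range m,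
      Integrable (fun ω => ‖gradMap f h γ (x τ k ω)‖ ^ 2) P := fun τ hτ k hk =>
    hrun.integrable_norm_gradMap_sq hn hb hℓ hℓd hL hf hh hγ hβ (hτT hτ) (Finset.mem_range.1 hk).le
  have iq : ∀ τ ∈ Finset.range (T + 1), ∀ k ∈ Finset.range m,
      Integrable (fun ω => γ / 2 * ‖directionError ℓ f β i G x τ k ω‖ ^ 2) P := fun τ hτ k hk =>
    (hrun.integrable_norm_directionError_sq hn hb hℓ hℓd hL hf hh hγ hβ (hτT hτ)
      (Finset.mem_range.1 hk)).const_mul _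
  have ia : ∀ τ ∈ Finset.range (T + 1), ∀ k ∈ Finset.range m, Integrable (fun ω =>
      (1 / (2 * γ) - L / 2) * ‖x τ (k + 1) ω - x τ k ω‖ ^ 2) P := fun τ hτ k hk =>
    (hrun.integrable_norm_iterate_sub_sq hb hℓ hℓd hL hf hh hγ hβ (hτT hτ)
      (Finset.mem_range.1 hk) (Finset.mem_range.1 hk).le).const_mul _
  have iqa : ∀ τ ∈ Finset.range (T + 1), ∀ k ∈ Finset.range m, Integrable (fun ω =>
      γ / 2 * ‖directionError ℓ f β i G x τ k ω‖ ^ 2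
        - (1 / (2 * γ) - L / 2) * ‖x τ (k + 1) ω - x τ k ω‖ ^ 2) P := fun τ hτ k hk =>
    (iq τ hτ k hk).sub (ia τ hτ k hk)
  have hpt := integral_mono
    ((integrable_finsetSum _ fun τ hτ => integrable_finsetSum _ (ig τ hτ)).const_mul _)
    ((integrable_const (avg f x₀ + (h x₀).toReal - F)).add
      (integrable_finsetSum _ fun τ hτ => integrable_finsetSum _ (iqa τ hτ)))
    fun ω => hrun.sum_norm_gradMap_sq_le hn hL hf hh hγ hx₀ hF ω
  have e1 : ∫ ω, (1 / 2 - L * γ) * γ * ∑ τ ∈ Finset.range (T + 1), ∑ k ∈ Finset.range m,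
        ‖gradMap f h γ (x τ k ω)‖ ^ 2 ∂P
      = (1 / 2 - L * γ) * γ * ∑ τ ∈ Finset.range (T + 1), ∑ k ∈ Finset.range m,
        ∫ ω, ‖gradMap f h γ (x τ k ω)‖ ^ 2 ∂P := by
    rw [integral_const_mul,
      integral_finsetSum _ fun τ hτ => integrable_finsetSum _ (ig τ hτ)]
    congr 1
    exact Finset.sum_congr rfl fun τ hτ => integral_finsetSum _ (ig τ hτ)
  have e2 : ∫ ω, ∑ τ ∈ Finset.range (T + 1), ∑ k ∈ Finset.range m,
        (γ / 2 * ‖directionError ℓ f β i G x τ k ω‖ ^ 2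
          - (1 / (2 * γ) - L / 2) * ‖x τ (k + 1) ω - x τ k ω‖ ^ 2) ∂P
      = ∑ τ ∈ Finset.range (T + 1), ∑ k ∈ Finset.range m,
        (γ / 2 * ∫ ω, ‖directionError ℓ f β i G x τ k ω‖ ^ 2 ∂P
          - (1 / (2 * γ) - L / 2) * ∫ ω, ‖x τ (k + 1) ω - x τ k ω‖ ^ 2 ∂P) := by
    rw [integral_finsetSum _ fun τ hτ => integrable_finsetSum _ (iqa τ hτ)]
    refine Finset.sum_congr rfl fun τ hτ => ?_
    rw [integral_finsetSum _ (iqa τ hτ)]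
    refine Finset.sum_congr rfl fun k hk => ?_
    rw [integral_sub (iq τ hτ k hk) (ia τ hτ k hk), integral_const_mul, integral_const_mul]
  have e3 : ∫ ω, (avg f x₀ + (h x₀).toReal - F + ∑ τ ∈ Finset.range (T + 1),
        ∑ k ∈ Finset.range m, (γ / 2 * ‖directionError ℓ f β i G x τ k ω‖ ^ 2
          - (1 / (2 * γ) - L / 2) * ‖x τ (k + 1) ω - x τ k ω‖ ^ 2)) ∂P
      = avg f x₀ + (h x₀).toReal - F + ∑ τ ∈ Finset.range (T + 1), ∑ k ∈ Finset.range m,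
        (γ / 2 * ∫ ω, ‖directionError ℓ f β i G x τ k ω‖ ^ 2 ∂P
          - (1 / (2 * γ) - L / 2) * ∫ ω, ‖x τ (k + 1) ω - x τ k ω‖ ^ 2 ∂P) := by
    rw [integral_add (integrable_const _)
      (integrable_finsetSum _ fun τ hτ => integrable_finsetSum _ (iqa τ hτ)), e2]
    simp
  have hpt' : _ ≤ _ := hpt
  rw [e1] at hpt'
  refine (hpt'.trans (le_of_eq e3)).trans ?_
  gcongr
  refine (Finset.sum_le_sum fun τ hτ => hrun.sum_integral_error_le hn hb hℓ hℓd hL hf hh hγ hβ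
    hstep (hτT hτ)).trans (le_of_eq ?_)
  rw [Finset.mul_sum]
  refine Finset.sum_congr rfl fun τ _ => ?_
  ring

end IsRun

end VRSZD

end

theorem theorem1 {Ω : Type*} [MeasurableSpace Ω] (P : Measure Ω) [IsProbabilityMeasure P]
    (d n b ℓ m T : ℕ) (hn : 0 < n) (hb : 0 < b) (hℓ : 1 ≤ ℓ) (hℓd : ℓ ≤ d) (hm : 1 < m)
    (L : ℝ) (hL : 0 < L)
    (f : Fin n → VRSZD.E d → ℝ) (hf : ∀ i, VRSZD.IsSmoothWith L (f i))
    (h : VRSZD.E d → EReal) (hh : VRSZD.IsConvexProximable h)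
    (xmin : VRSZD.E d) (hmin : ∀ y, VRSZD.objective f h xmin ≤ VRSZD.objective f h y)
    (β : ℕ → ℝ) (hβ : ∀ τ, 0 < β τ)
    (γ : ℝ) (hγ : 0 < γ)
    (hγ_lt : γ < min (1 / (4 * L))
      (√((ℓ : ℝ) * b) / (√(32 * (Real.exp 1 - 1) * d) * L * m)))
    (Δ : ℝ) (hΔ : Δ = 1 / 2 - L * γ)
    (x₀ : VRSZD.E d)
    (i : ℕ → ℕ → Fin b → Ω → Fin n) (G : ℕ → ℕ → Fin b → Ω → VRSZD.O d)
    (x : ℕ → ℕ → Ω → VRSZD.E d)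
    (hrun : VRSZD.IsRun P ℓ m T f h γ β x₀ i G x) :
    (∀ τ ≤ T, ∀ k < m, Integrable (fun ω => ‖VRSZD.gradMap f h γ (x τ k ω)‖ ^ 2) P) ∧
    ((VRSZD.eta P m T f h γ x : ℝ) : EReal) ≤
      (VRSZD.objective f h x₀ - VRSZD.objective f h xmin) /
          ((Δ * γ * m * ((T : ℝ) + 1) : ℝ) : EReal)
        + (((3 * (d : ℝ) / ((ℓ : ℝ) * b) + 2 + 3 * d) * (L ^ 2 * d / (Δ * ((T : ℝ) + 1)))
          * ∑ τ ∈ Finset.range (T + 1), β τ ^ 2 : ℝ) : EReal) := by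
  obtain ⟨hγ₁, hγ₂⟩ := lt_min_iff.1 hγ_lt
  have hd' : (0 : ℝ) < d := by exact_mod_cast hℓ.trans hℓd
  have hm' : (0 : ℝ) < m := by exact_mod_cast (zero_lt_one.trans hm)
  have hb' : (0 : ℝ) < b := by exact_mod_cast hb
  have hℓ' : (0 : ℝ) < ℓ := by exact_mod_cast hℓ
  have hT' : (0 : ℝ) < (T : ℝ) + 1 := by positivity
  have hΔ0 : 0 < Δ := by
    rw [lt_div_iff₀ (by positivity)] at hγ₁
    rw [hΔ]
    linarith
  refine ⟨fun τ hτ k hk => hrun.integrable_norm_gradMap_sq hn hb hℓ hℓd hL.le hf hh hγ hβ hτ hk.le,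
    ?_⟩
  obtain ⟨hxmin, hF⟩ := VRSZD.avg_add_toReal_le hh hmin
  have hpos : 0 < Δ * γ * m * ((T : ℝ) + 1) := by positivity
  have hFmin : VRSZD.objective f h xmin
      = ((VRSZD.avg f xmin + (h xmin).toReal : ℝ) : EReal) := by
    rw [VRSZD.objective, EReal.coe_add, EReal.coe_toReal hxmin (hh.ne_bot _)]
  -- `toReal` would send `⊤` to `0`, so an infinite initial value is treated separately; there the
  -- right-hand side is `⊤`.
  by_cases hx₀ : h x₀ = ⊤
  · have hF₀ : VRSZD.objective f h x₀ = ⊤ := by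
      rw [VRSZD.objective, hx₀, EReal.coe_add_top]
    rw [hF₀, hFmin, EReal.top_sub_coe,
      EReal.top_div_of_pos_ne_top (EReal.coe_pos.2 hpos) (EReal.coe_ne_top _), EReal.top_add_coe]
    exact le_top
  · have hF₀ : VRSZD.objective f h x₀
        = ((VRSZD.avg f x₀ + (h x₀).toReal : ℝ) : EReal) := by
      rw [VRSZD.objective, EReal.coe_add, EReal.coe_toReal hx₀ (hh.ne_bot _)]
    rw [hF₀, hFmin, ← EReal.coe_sub, ← EReal.coe_div, ← EReal.coe_add, EReal.coe_le_coe_iff]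
    have hmain := hrun.sum_integral_norm_gradMap_sq_le hn hb hℓ hℓd hL.le hf hh hγ hβ
      (VRSZD.step_size_le hb hℓ hℓd hm hL hγ hγ₁ hγ₂) hx₀ hF
    rw [← hΔ] at hmain
    rw [VRSZD.eta]
    set S := ∑ τ ∈ Finset.range (T + 1), ∑ k ∈ Finset.range m,
      ∫ ω, ‖VRSZD.gradMap f h γ (x τ k ω)‖ ^ 2 ∂P
    set B := ∑ τ ∈ Finset.range (T + 1), β τ ^ 2
    have hB : 0 ≤ B := Finset.sum_nonneg fun τ _ => by positivity
    set F₀ := VRSZD.avg f x₀ + (h x₀).toReal - (VRSZD.avg f xmin + (h xmin).toReal)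
    have h1 : 1 / (((T : ℝ) + 1) * m) * S = Δ * γ * S / (Δ * γ * m * ((T : ℝ) + 1)) := by
      field_simp
    have h2 : (3 * (d : ℝ) / ((ℓ : ℝ) * b) + 2 + 3 * d) * (L ^ 2 * d / (Δ * ((T : ℝ) + 1))) * B
        = (m * γ * ((3 * (d : ℝ) / (ℓ * b) + 2 + 3 * d) * (d * L ^ 2)) * B)
          / (Δ * γ * m * ((T : ℝ) + 1)) := by
      field_simp
    rw [h1, h2, ← add_div]
    refine div_le_div_of_nonneg_right (hmain.trans ?_) hpos.le
    -- The argument gives half of `2d/(ℓb) + 2d + 1/2`, hence less than the claimed `3d/(ℓb) + 2 +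
    -- 3d`.
    refine add_le_add le_rfl (mul_le_mul_of_nonneg_right ?_ hB)
    rw [mul_div_assoc, mul_assoc (m : ℝ), mul_assoc (m : ℝ), div_mul_eq_mul_div, mul_div_assoc]
    gcongr
    rw [mul_div_right_comm]
    gcongr
    have h3 : 0 ≤ (d : ℝ) / (ℓ * b) := by positivity
    have h4 : 2 * (d : ℝ) / (ℓ * b) = 2 * (d / (ℓ * b)) := mul_div_assoc _ _ _
    have h5 : 3 * (d : ℝ) / (ℓ * b) = 3 * (d / (ℓ * b)) := mul_div_assoc _ _ _
    rw [h4, h5]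
    linarith
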